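/- Definitions. A countable Borel equivalence relation (CBER) $(X,E)$ is an equivalence relation $E$ on a standard Borel space $X$ (possibly empty) which is Borel as a subset of $X^2$ and all of whose classes are countable; $\mathcal E$ denotes the class of all CBERs. For $(X,E),(Y,F)\in\mathcal E$: $E\cong_B F$ means that there is a Borel isomorphism of $X$ onto $Y$ carrying $E$ to $F$; $E\sqsubseteq_B^i F$ means that there is an injective Borel map $f:X\to Y$ with $x\mathrel E x'\iff f(x)\mathrel F f(x')$ and with $f(X)$ $F$-invariant; a class-bijective homomorphism $f:E\to_B^{cb}F$ is a Borel map $f:X\to Y$ such that $x\mathrel E x'\implies f(x)\mathrel F f(x')$ and $f$ restricts to a bijection $[x]_E\to[f(x)]_F$ for every $x\in X$. A theory is a pair $(L,\sigma)$ of a countable relational language $L$ (all arities at least $1$) and an $L_{\omega_1\omega}$-sentence $\sigma$. A CBER $(X,E)$ is $\sigma$-structurable if there is an $L$-structure $\mathbb A$ on $X$ whose relations are Borel and only relate elements of the same $E$-class, such that $\mathbb A|C\models\sigma$ for every $E$-class $C$. A CBER $E$ is universally structurable if, for some theory $(L,\sigma)$, $E$ is $\sigma$-structurable and $F\sqsubseteq_B^i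 E$ for every $\sigma$-structurable CBER $F$. Let $\mathcal E_\infty\subseteq\mathcal E$ be the class of universally structurable CBERs. Let $E_\infty$ denote an invariantly universal CBER, i.e. one with $F\sqsubseteq_B^i E_\infty$ for all $F\in\mathcal E$, and $\emptyset$ the empty equivalence relation on the empty set. For a countable family $(E_i)_i$ of CBERs, $\bigoplus_i E_i$ is the disjoint sum (on the disjoint union of the underlying spaces), and, when the family is nonempty, $\bigotimes_i E_i$ is the class-bijective (tensor) product, i.e. the categorical product of the $E_i$ in the category of CBERs and class-bijective homomorphisms: a CBER with class-bijective homomorphisms $\pi_i$ to the $E_i$ such that for every CBER $G$ and class-bijective homomorphisms $f_i:G\to_B^{cb}E_i$ there is a unique class-bijective homomorphism $h:G\to_B^{cb}\bigotimes_i E_i$ with $\pi_i\circ h=f_i$ for all $i$. A poset is an $\omega_1$-distributive lattice if every countable subset has a greatest lower bound and a least upper bound, and $x\wedge\bigvee_i y_i=\bigvee_i(x\wedge y_i)$ and $x\vee\bigwedge_i y_i=\bigwedge_i(x\vee y_i)$ for all $x$ and all countable families $(y_i)_i$. Theorem. The poset $(\mathcal E_\infty/{\cong_B},\sqsubseteq_B^i)$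 is an $\omega_1$-distributive lattice. In it: (1) the join of a countable family $(E_i)_i$ is $\bigoplus_i E_i$; (2) for every nonempty countable family $(E_i)_i$ in $\mathcal E_\infty$, $\bigotimes_i E_i$ exists, is universally structurable, and is the meet of the family; (3) an invariantly universal $E_\infty$ exists, and it is the greatest element; (4) $\emptyset$ is the least element. Moreover, the inclusion $(\mathcal E_\infty/{\cong_B},\sqsubseteq_B^i)\subseteq(\mathcal E/{\cong_B},\sqsubseteq_B^i)$ preserves countable meets and joins; in particular, for universally structurable $E_0,E_1,\dots$, $\bigotimes_i E_i$ (respectively $\bigoplus_i E_i$) is their meet (respectively join) in $(\mathcal E/{\cong_B},\sqsubseteq_B^i)$ as well as in $(\mathcal E_\infty/{\cong_B},\sqsubseteq_B^i)$. -/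

import Mathlib

open Set MeasureTheory

/-! ### Countable Borel equivalence relations -/

/-- A countable Borel equivalence relation `(X, E)` on a (possibly empty) standard Borel space. -/
structure CBER : Type 1 where
  /-- the underlying standard Borel space `X` -/
  carrier : Type
  [measurableSpace : MeasurableSpace carrier]
  [standardBorel : StandardBorelSpace carrier]
  /-- the equivalence relation `E` -/
  rel : carrier → carrier → Prop
  equivalence : Equivalence rel
  /-- `E` is a Borel subset of `X × X` -/
  measurable_rel : MeasurableSet {p : carrier × carrier | rel p.1 p.2}
  /-- every `E`-class is countable -/
  countable_class : ∀ x, {y | rel x y}.Countable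

attribute [instance] CBER.measurableSpace CBER.standardBorel

namespace CBER

/-- The equivalence class `[x]_E`. -/
def cls (E : CBER) (x : E.carrier) : Set E.carrier := {y | E.rel x y}

/-- A class-bijective Borel homomorphism `f : E →_B^{cb} F`: a Borel map that sends related points
to related points and restricts to a bijection from each class `[x]_E` onto `[f(x)]_F`. -/
structure IsClassBijective (E F : CBER) (f : E.carrier → F.carrier) : Prop where
  measurable : Measurable f
  map_rel : ∀ x y, E.rel x y → F.rel (f x) (f y)
  bijOn : ∀ x, BijOn f (E.cls x) (F.cls (f x))

/-- An invariant Borel embedding `f : E ⊑_B^i F`: an injective Borel reduction of `E` to `F` whose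
image is an `F`-invariant set. -/
structure IsInvariantEmbedding (E F : CBER) (f : E.carrier → F.carrier) : Prop where
  measurable : Measurable f
  injective : Function.Injective f
  map_rel_iff : ∀ x y, F.rel (f x) (f y) ↔ E.rel x y
  invariant_range : ∀ x y, F.rel (f x) y → y ∈ range f

/-- `E ⊑_B^i F`: there is an invariant Borel embedding of `E` into `F`. -/
def InvEmbeds (E F : CBER) : Prop := ∃ f, IsInvariantEmbedding E F f

/-- `E ≅_B F`: there is a Borel isomorphism of `X` with `Y` carrying `E` to `F`. -/
def Iso (E F : CBER) : Prop :=
  ∃ e : E.carrier ≃ᵐ F.carrier, ∀ x y, F.rel (e x) (e y) ↔ E.rel x y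

theorem Iso.refl (E : CBER) : Iso E E := ⟨MeasurableEquiv.refl _, fun _ _ => Iff.rfl⟩

theorem Iso.symm {E F : CBER} : Iso E F → Iso F E := by
  rintro ⟨e, he⟩
  exact ⟨e.symm, fun x y => by simpa using (he (e.symm x) (e.symm y)).symm⟩

theorem Iso.trans {E F G : CBER} : Iso E F → Iso F G → Iso E G := by
  rintro ⟨e, he⟩ ⟨e', he'⟩
  exact ⟨e.trans e', fun x y => by simp [he', he]⟩

theorem Iso.invEmbeds {E F : CBER} : Iso E F → InvEmbeds E F := by
  rintro ⟨e, he⟩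
  exact ⟨e, e.measurable, e.injective, he, fun _ y _ => ⟨e.symm y, by simp⟩⟩

theorem IsInvariantEmbedding.comp {E F G : CBER} {f : E.carrier → F.carrier}
    {g : F.carrier → G.carrier} (hg : IsInvariantEmbedding F G g)
    (hf : IsInvariantEmbedding E F f) : IsInvariantEmbedding E G (g ∘ f) where
  measurable := hg.measurable.comp hf.measurable
  injective := hg.injective.comp hf.injective
  map_rel_iff x y := (hg.map_rel_iff _ _).trans (hf.map_rel_iff _ _)
  invariant_range x z h := by
    obtain ⟨y, rfl⟩ := hg.invariant_range _ _ h
    obtain ⟨w, rfl⟩ := hf.invariant_range x y ((hg.map_rel_iff _ _).1 h)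
    exact ⟨w, rfl⟩

theorem InvEmbeds.trans {E F G : CBER} : InvEmbeds E F → InvEmbeds F G → InvEmbeds E G := by
  rintro ⟨f, hf⟩ ⟨g, hg⟩
  exact ⟨g ∘ f, hg.comp hf⟩

/-- The Borel Schröder-Bernstein theorem for invariant embeddings. -/
theorem InvEmbeds.antisymm {E F : CBER} : InvEmbeds E F → InvEmbeds F E → Iso E F := by
  rintro ⟨f, hf⟩ ⟨g, hg⟩
  have hgf := hg.comp hf
  set k := g ∘ f with hk
  have hge := hg.measurable.measurableEmbedding hg.injective
  set S : ℕ → Set E.carrier := fun n => k^[n] '' (range g)ᶜ with hS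
  have hSm : ∀ n, MeasurableSet (S n) := fun n =>
    ((hgf.measurable.iterate n).measurableEmbedding (hgf.injective.iterate n)).measurableSet_image'
      hge.measurableSet_range.compl
  have hSinv : ∀ n x y, x ∈ S n → E.rel x y → y ∈ S n := by
    intro n
    induction n with
    | zero =>
      rintro x y ⟨z, hz, rfl⟩ hxy
      refine ⟨y, ?_, rfl⟩
      rintro ⟨w, rfl⟩
      exact hz (hg.invariant_range w z (E.equivalence.symm hxy))
    | succ n ih =>
      rintro x y ⟨z, hz, rfl⟩ hxy
      rw [Function.iterate_succ_apply'] at hxy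
      obtain ⟨w, rfl⟩ := hgf.invariant_range _ _ hxy
      obtain ⟨v, hv, hvw⟩ := ih _ w ⟨z, hz, rfl⟩ ((hgf.map_rel_iff _ _).1 hxy)
      exact ⟨v, hv, by rw [Function.iterate_succ_apply', hvw]⟩
  set A : Set E.carrier := ⋃ n, S n with hA
  have hAm : MeasurableSet A := MeasurableSet.iUnion hSm
  have hAinv : ∀ x y, x ∈ A → E.rel x y → y ∈ A := by
    intro x y hx hxy
    obtain ⟨n, hn⟩ := mem_iUnion.1 hx
    exact mem_iUnion.2 ⟨n, hSinv n x y hn hxy⟩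
  have hAk : ∀ x, x ∈ A → g (f x) ∈ A := by
    intro x hx
    obtain ⟨n, z, hz, rfl⟩ := mem_iUnion.1 hx
    exact mem_iUnion.2 ⟨n + 1, z, hz, Function.iterate_succ_apply' _ _ _⟩
  have hAg : ∀ y, g y ∈ A → ∃ w ∈ A, f w = y := by
    intro y hy
    obtain ⟨n, z, hz, hzy⟩ := mem_iUnion.1 hy
    cases n with
    | zero => exact (hz ⟨y, hzy.symm⟩).elim
    | succ n =>
      rw [Function.iterate_succ_apply'] at hzy
      exact ⟨_, mem_iUnion.2 ⟨n, z, hz, rfl⟩, hg.injective hzy⟩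
  have hex : ∀ x, ∃ y, (x ∈ A ∧ y = f x) ∨ (x ∉ A ∧ g y = x) := by
    intro x
    by_cases hx : x ∈ A
    · exact ⟨f x, Or.inl ⟨hx, rfl⟩⟩
    · have : x ∈ range g := by
        by_contra h
        exact hx (mem_iUnion.2 ⟨0, x, h, rfl⟩)
      obtain ⟨y, hy⟩ := this
      exact ⟨y, Or.inr ⟨hx, hy⟩⟩
  choose h hh using hex
  have hrel : ∀ x y, F.rel (h x) (h y) ↔ E.rel x y := by
    have key : ∀ x y, x ∈ A → h x = f x → y ∉ A → g (h y) = y →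
        ¬ F.rel (h x) (h y) ∧ ¬ E.rel x y := by
      intro x y hx hfx hy hgy
      refine ⟨fun hr => ?_, fun hr => hy (hAinv x y hx hr)⟩
      rw [hfx] at hr
      obtain ⟨w, hw⟩ := hf.invariant_range _ _ hr
      rw [← hw] at hr hgy
      exact hy (hgy ▸ hAk w (hAinv x w hx ((hf.map_rel_iff _ _).1 hr)))
    intro x y
    rcases hh x with ⟨hx, hfx⟩ | ⟨hx, hgx⟩ <;> rcases hh y with ⟨hy, hfy⟩ | ⟨hy, hgy⟩
    · rw [hfx, hfy, hf.map_rel_iff]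
    · exact iff_of_false (key x y hx hfx hy hgy).1 (key x y hx hfx hy hgy).2
    · exact iff_of_false (fun hr => (key y x hy hfy hx hgx).1 (F.equivalence.symm hr))
        (fun hr => (key y x hy hfy hx hgx).2 (E.equivalence.symm hr))
    · rw [← hg.map_rel_iff, hgx, hgy]
  have hinj : Function.Injective h := by
    intro x y hxy
    rcases hh x with ⟨hx, hfx⟩ | ⟨hx, hgx⟩ <;> rcases hh y with ⟨hy, hfy⟩ | ⟨hy, hgy⟩
    · exact hf.injective (by rw [← hfx, ← hfy, hxy])
    · exact (hy (by rw [← hgy, ← hxy, hfx]; exact hAk x hx)).elim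
    · exact (hx (by rw [← hgx, hxy, hfy]; exact hAk y hy)).elim
    · rw [← hgx, ← hgy, hxy]
  have hsurj : Function.Surjective h := by
    intro y
    by_cases hy : g y ∈ A
    · obtain ⟨w, hw, rfl⟩ := hAg y hy
      rcases hh w with ⟨_, h1⟩ | ⟨h1, _⟩
      · exact ⟨w, h1⟩
      · exact (h1 hw).elim
    · rcases hh (g y) with ⟨h1, _⟩ | ⟨_, h1⟩
      · exact (hy h1).elim
      · exact ⟨g y, hg.injective h1⟩
  have hmeas : Measurable h := by
    intro s hs
    have : h ⁻¹' s = (A ∩ f ⁻¹' s) ∪ (Aᶜ ∩ g '' s) := by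
      ext x
      rcases hh x with ⟨hx, hfx⟩ | ⟨hx, hgx⟩
      · simp [hx, hfx]
      · have : x ∈ g '' s ↔ h x ∈ s := by
          conv_lhs => rw [← hgx]
          exact hg.injective.mem_set_image
        simp [hx, this]
    rw [this]
    exact (hAm.inter (hf.measurable hs)).union (hAm.compl.inter (hge.measurableSet_image' hs))
  refine ⟨⟨Equiv.ofBijective h ⟨hinj, hsurj⟩, hmeas, fun s hs => ?_⟩, hrel⟩
  rw [← Equiv.image_eq_preimage_symm]
  exact (hmeas.measurableEmbedding hinj).measurableSet_image' hs

/-! ### The poset of isomorphism classes -/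

/-- Borel isomorphism as an equivalence relation on the class of all countable Borel equivalence
relations. -/
instance isoSetoid : Setoid CBER := ⟨Iso, Iso.refl, Iso.symm, Iso.trans⟩

/-- The class of all countable Borel equivalence relations modulo Borel isomorphism. -/
def IsoClass : Type 1 := Quotient isoSetoid

/-- The Borel isomorphism class of `E`. -/
def toIsoClass (E : CBER) : IsoClass := Quotient.mk isoSetoid E

/-- Isomorphism classes are ordered by invariant Borel embeddability `⊑_B^i`. -/
instance : PartialOrder IsoClass where
  le := Quotient.lift₂ InvEmbeds fun _ _ _ _ h₁ h₂ => propext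
    ⟨fun h => (Iso.invEmbeds (Iso.symm h₁)).trans (h.trans (Iso.invEmbeds h₂)),
      fun h => (Iso.invEmbeds h₁).trans (h.trans (Iso.invEmbeds (Iso.symm h₂)))⟩
  le_refl := by
    rintro ⟨E⟩
    exact Iso.invEmbeds (Iso.refl E)
  le_trans := by
    rintro ⟨E⟩ ⟨F⟩ ⟨G⟩
    exact InvEmbeds.trans
  le_antisymm := by
    rintro ⟨E⟩ ⟨F⟩ h₁ h₂
    exact Quotient.sound (InvEmbeds.antisymm h₁ h₂)

end CBER

/-! ### Structurability -/

/-- Formulas of the infinitary logic `L_{ω₁ω}` over a relational language `L`, with free variables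
among `x_0, …, x_{n-1}`. Conjunctions over `ℕ` are the countable conjunctions; disjunctions,
negations and existential quantifiers are expressed through the given connectives as usual. -/
inductive InfFormula (L : FirstOrder.Language.{0, 0}) : ℕ → Type
  | falsum {n : ℕ} : InfFormula L n
  | equal {n : ℕ} (i j : Fin n) : InfFormula L n
  | rel {n k : ℕ} (R : L.Relations k) (v : Fin k → Fin n) : InfFormula L n
  | imp {n : ℕ} (φ ψ : InfFormula L n) : InfFormula L n
  | conj {n : ℕ} (φ : ℕ → InfFormula L n) : InfFormula L n
  | all {n : ℕ} (φ : InfFormula L (n + 1)) : InfFormula L n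

/-- Satisfaction of an `L_{ω₁ω}`-formula in the structure `A` with universe `M`. -/
def InfFormula.Realize {L : FirstOrder.Language.{0, 0}} {M : Type} (A : L.Structure M) :
    {n : ℕ} → InfFormula L n → (Fin n → M) → Prop
  | _, .falsum, _ => False
  | _, .equal i j, v => v i = v j
  | _, .rel R w, v => A.RelMap R (fun i => v (w i))
  | _, .imp φ ψ, v => φ.Realize A v → ψ.Realize A v
  | _, .conj φ, v => ∀ m, (φ m).Realize A v
  | _, .all φ, v => ∀ a : M, φ.Realize A (Fin.snoc v a)

/-- A theory `(L, σ)`: a countable relational language `L`, all of whose symbols have arity at least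
one, together with an `L_{ω₁ω}`-sentence `σ`. -/
structure InfTheory : Type 1 where
  language : FirstOrder.Language.{0, 0}
  isRelational : language.IsRelational
  countable : Countable (Σ n, language.Relations n)
  arity_pos : IsEmpty (language.Relations 0)
  sentence : InfFormula language 0

/-- The restriction `A|C` of a structure in a relational language to a subset `C` of its universe. -/
abbrev restrictStructure {L : FirstOrder.Language.{0, 0}} (hL : L.IsRelational) {X : Type}
    (A : L.Structure X) (C : Set X) : L.Structure C where
  funMap f := ((hL _).false f).elim
  RelMap R v := A.RelMap R (fun i => (v i : X))

namespace CBER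

/-- `A : E ⊨ σ`, i.e. `A` is a Borel `σ`-structure on `E`: its relations are Borel, they relate only
elements of the same `E`-class, and `A|C` satisfies `σ` for each `E`-class `C`. -/
structure IsBorelStructureOn (E : CBER) (σ : InfTheory) (A : σ.language.Structure E.carrier) :
    Prop where
  measurable : ∀ (n : ℕ) (R : σ.language.Relations n), MeasurableSet {v | A.RelMap R v}
  rel_of_relMap : ∀ (n : ℕ) (R : σ.language.Relations n) (v : Fin n → E.carrier),
    A.RelMap R v → ∀ i j, E.rel (v i) (v j)
  realize : ∀ x, σ.sentence.Realize (restrictStructure σ.isRelational A (E.cls x)) Fin.elim0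

/-- `E ⊨ σ`: the equivalence relation `E` is `σ`-structurable. -/
def Structurable (E : CBER) (σ : InfTheory) : Prop := ∃ A, IsBorelStructureOn E σ A

/-- The elementary class of all `σ`-structurable countable Borel equivalence relations. -/
def elementaryClass (σ : InfTheory) : Set CBER := {E | E.Structurable σ}

/-- `E` is universally structurable: it is invariantly universal in some elementary class, i.e. for
some theory `σ` it is `σ`-structurable and every `σ`-structurable `F` satisfies `F ⊑_B^i E`. -/
def UniversallyStructurable (E : CBER) : Prop :=
  ∃ σ : InfTheory, E ∈ elementaryClass σ ∧ ∀ F ∈ elementaryClass σ, InvEmbeds F E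

/-- `E` is an invariantly universal countable Borel equivalence relation `E_∞`: every countable
Borel equivalence relation invariantly embeds into it. -/
def InvariantlyUniversal (E : CBER) : Prop := ∀ F : CBER, InvEmbeds F E

/-- The isomorphism classes of universally structurable countable Borel equivalence relations, as a
subposet of all isomorphism classes. -/
abbrev UnivStrClass : Type 1 :=
  {c : IsoClass // ∃ E : CBER, E.UniversallyStructurable ∧ E.toIsoClass = c}

/-- The isomorphism class of a universally structurable `E`, in the subposet. -/
def UniversallyStructurable.toClass {E : CBER} (h : E.UniversallyStructurable) : UnivStrClass :=
  ⟨E.toIsoClass, E, h, rfl⟩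

/-! ### Sums, class-bijective products, and the empty equivalence relation -/

/-- The empty equivalence relation on the empty set. -/
def empty : CBER where
  carrier := Empty
  rel _ _ := True
  equivalence := ⟨fun _ => trivial, fun _ => trivial, fun _ _ => trivial⟩
  measurable_rel := MeasurableSet.univ
  countable_class x := x.elim

/-- A countable disjoint union of standard Borel spaces is standard Borel. -/
theorem standardBorelSpace_sigma {ι : Type} [Countable ι] (X : ι → Type)
    [∀ i, MeasurableSpace (X i)] [∀ i, StandardBorelSpace (X i)] :
    StandardBorelSpace (Σ i, X i) := by
  let (i : ι) := upgradeStandardBorel (X i)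
  have : BorelSpace (Σ i, X i) := by
    refine ⟨le_antisymm ?_ ?_⟩
    · intro s hs
      have hs' : ∀ i, MeasurableSet (Sigma.mk i ⁻¹' s) :=
        fun i => (MeasurableSpace.measurableSet_iInf.1 hs) i
      have : s = ⋃ i, Sigma.mk i '' (Sigma.mk i ⁻¹' s) := by
        ext ⟨i, x⟩
        simp only [mem_iUnion]
        constructor
        · exact fun h => ⟨i, x, h, rfl⟩
        · rintro ⟨j, y, h, e⟩
          exact e ▸ h
      rw [this]
      let : MeasurableSpace (Σ i, X i) := borel _
      have : BorelSpace (Σ i, X i) := ⟨rfl⟩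
      exact MeasurableSet.iUnion fun i =>
        (Topology.IsOpenEmbedding.sigmaMk.measurableEmbedding).measurableSet_image' (hs' i)
    · refine MeasurableSpace.generateFrom_le fun s hs => ?_
      refine MeasurableSpace.measurableSet_iInf.2 fun i => ?_
      exact (IsOpen.preimage continuous_sigmaMk hs).measurableSet
  infer_instance

/-- A subset of a countable disjoint union is Borel if its pieces are; stated for relations. -/
theorem measurableSet_sigma_rel {ι : Type} [Countable ι] (X : ι → Type)
    [∀ i, MeasurableSpace (X i)] (r : ∀ i, X i → X i → Prop)
    (hr : ∀ i, MeasurableSet {p : X i × X i | r i p.1 p.2}) :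
    MeasurableSet {p : (Σ i, X i) × (Σ i, X i) |
      ∃ (i : ι) (x y : X i), r i x y ∧ p.1 = ⟨i, x⟩ ∧ p.2 = ⟨i, y⟩} := by
  have hmk : ∀ i, MeasurableEmbedding (Sigma.mk i : X i → Σ i, X i) := by
    intro i
    refine ⟨sigma_mk_injective, fun s hs => ?_, fun s hs => ?_⟩
    · exact (MeasurableSpace.measurableSet_iInf.1 hs) i
    · refine MeasurableSpace.measurableSet_iInf.2 fun j => ?_
      change MeasurableSet (Sigma.mk j ⁻¹' (Sigma.mk i '' s))
      by_cases hij : i = j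
      · subst hij
        rwa [preimage_image_eq _ sigma_mk_injective]
      · convert MeasurableSet.empty
        ext x
        simp only [mem_preimage, mem_image, mem_empty_iff_false, iff_false]
        rintro ⟨y, _, h⟩
        exact hij (congrArg Sigma.fst h)
  have : {p : (Σ i, X i) × (Σ i, X i) |
      ∃ (i : ι) (x y : X i), r i x y ∧ p.1 = ⟨i, x⟩ ∧ p.2 = ⟨i, y⟩} =
      ⋃ i, Prod.map (Sigma.mk i) (Sigma.mk i) '' {p : X i × X i | r i p.1 p.2} := by
    ext ⟨p, q⟩
    simp only [mem_ofPred_eq, mem_iUnion, mem_image, Prod.exists, Prod.map_apply, Prod.mk.injEq]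
    constructor
    · rintro ⟨i, x, y, h, rfl, rfl⟩
      exact ⟨i, x, y, h, rfl, rfl⟩
    · rintro ⟨i, x, y, h, rfl, rfl⟩
      exact ⟨i, x, y, h, rfl, rfl⟩
  rw [this]
  exact MeasurableSet.iUnion fun i => ((hmk i).prodMap (hmk i)).measurableSet_image' (hr i)

/-- The disjoint sum `⨁ E_i` of a countable family: the disjoint union of the underlying spaces,
where the elements of each summand are related as in that summand, and elements of different
summands are unrelated. -/
def sum {ι : Type} [Countable ι] (E : ι → CBER) : CBER where
  carrier := Σ i, (E i).carrier
  standardBorel := standardBorelSpace_sigma _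
  rel p q := ∃ (i : ι) (x y : (E i).carrier), (E i).rel x y ∧ p = ⟨i, x⟩ ∧ q = ⟨i, y⟩
  equivalence := by
    refine ⟨?_, ?_, ?_⟩
    · rintro ⟨i, x⟩
      exact ⟨i, x, x, (E i).equivalence.refl x, rfl, rfl⟩
    · rintro _ _ ⟨i, x, y, h, rfl, rfl⟩
      exact ⟨i, y, x, (E i).equivalence.symm h, rfl, rfl⟩
    · rintro _ _ _ ⟨i, x, y, h, rfl, rfl⟩ ⟨j, y', z, h', e, rfl⟩
      cases e
      exact ⟨i, x, z, (E i).equivalence.trans h h', rfl, rfl⟩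
  measurable_rel := measurableSet_sigma_rel _ _ fun i => (E i).measurable_rel
  countable_class := by
    rintro ⟨i, x⟩
    refine (((E i).countable_class x).image (Sigma.mk (β := fun i => (E i).carrier) i)).mono ?_
    rintro _ ⟨j, x', y, h, e, rfl⟩
    cases e
    exact ⟨y, h, rfl⟩

/-- `(P, π)` is the class-bijective (tensor) product `⨂ E_i`: the categorical product of the family
`E` in the category of countable Borel equivalence relations and class-bijective Borel
homomorphisms. -/
structure IsTensorProduct {ι : Type} (E : ι → CBER) (P : CBER)
    (π : ∀ i, P.carrier → (E i).carrier) : Prop where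
  proj : ∀ i, IsClassBijective P (E i) (π i)
  existsUnique_lift : ∀ (G : CBER) (f : ∀ i, G.carrier → (E i).carrier),
    (∀ i, IsClassBijective G (E i) (f i)) →
      ∃! h : G.carrier → P.carrier, IsClassBijective G P h ∧ ∀ i, π i ∘ h = f i

end CBER

/-! ### Order theory -/

/-- A poset is an `ω₁`-complete lattice if every countable subset has a greatest lower bound and a
least upper bound. -/
def IsOmega1CompleteLattice (P : Type*) [PartialOrder P] : Prop :=
  ∀ A : Set P, A.Countable → (∃ m, IsGLB A m) ∧ ∃ j, IsLUB A j

/-- A poset is an `ω₁`-distributive lattice if it is an `ω₁`-complete lattice and satisfies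
`x ∧ ⋁ᵢ yᵢ = ⋁ᵢ (x ∧ yᵢ)` and `x ∨ ⋀ᵢ yᵢ = ⋀ᵢ (x ∨ yᵢ)` for all countable families `y`. (The
laws say that, if `s` is the join of the `yᵢ` and `mᵢ` is the meet of `x` and `yᵢ`, then the meet
of `x` and `s` is the join of the `mᵢ`; and dually.) -/
structure IsOmega1DistributiveLattice (P : Type*) [PartialOrder P] : Prop where
  complete : IsOmega1CompleteLattice P
  inf_iSup : ∀ (ι : Type) [Countable ι] (x : P) (y m : ι → P) (s t : P),
    IsLUB (range y) s → (∀ i, IsGLB {x, y i} (m i)) → IsGLB {x, s} t → IsLUB (range m) t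
  sup_iInf : ∀ (ι : Type) [Countable ι] (x : P) (y m : ι → P) (s t : P),
    IsGLB (range y) s → (∀ i, IsLUB {x, y i} (m i)) → IsLUB {x, s} t → IsGLB (range m) t

/-! The pivot is that E is universally structurable exactly when it is absorbing: every F with a
class-bijective homomorphism to E invariantly embeds into E
(`universallyStructurable_iff_absorbing`). In one direction, structures pull back along
class-bijective maps. In the other, the F admitting such a map are the models of a single sentence,
whose unary predicates record a code of the image point (`exists_theory`). After this, only
class-bijective maps matter, and invariant embeddings are the injective ones among them.

Meets. A family of embeddings of G into the E_i lifts to the tensor product, and the lift is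
injective because its composite with a projection is. Absorption turns the projections themselves
into embeddings. The product is realized by countable sets of tuples that project bijectively onto a
class in each coordinate, each presented by a canonical enumeration.

Joins. A sum of absorbing relations is absorbing by cutting the source into invariant pieces. The
hard point is leastness: given embeddings of the E_i into G, their images may overlap. Absorption
puts countably many disjoint copies of E_i inside E_i, and colliding classes are moved into such
copies with a record of their origin (`InvEmbeds.sum_of_absorbing`).

In both cases G is an arbitrary countable Borel equivalence relation, so these bounds are bounds
among all isomorphism classes and the inclusion preserves them. Both distributive laws come from
cutting a relation into invariant Borel pieces and summing again.

All Borel enumerations of classes rest on Lusin–Novikov. It is proved by a dichotomy: if the domain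
is not a countable union of Borel sets of injectivity, a tree construction maps Cantor space
continuously into one fibre, separating the edges of a graph of G₀ type, and Baire category
contradicts countability of the fibre. -/

/-! ### The Lusin–Novikov theorem for countable-to-one maps -/

namespace LusinNovikov

open Filter Topology

variable {X Z T : Type*}

/-- A set is small for `p` if it is covered by countably many measurable sets on which `p` is
injective. -/
def IsSmall [MeasurableSpace Z] (p : Z → X) (D : Set Z) : Prop :=
  ∃ s : ℕ → Set Z, (∀ n, MeasurableSet (s n) ∧ InjOn p (s n)) ∧ D ⊆ ⋃ n, s n

theorem IsSmall.mono [MeasurableSpace Z] {p : Z → X} {D D' : Set Z} (h : IsSmall p D)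
    (hD : D' ⊆ D) : IsSmall p D' := by
  obtain ⟨s, hs, h⟩ := h
  exact ⟨s, hs, hD.trans h⟩

theorem IsSmall.exists_measurable [MeasurableSpace Z] {p : Z → X} {D : Set Z} (h : IsSmall p D) :
    ∃ D', D ⊆ D' ∧ MeasurableSet D' ∧ IsSmall p D' := by
  obtain ⟨s, hs, h⟩ := h
  exact ⟨⋃ n, s n, h, MeasurableSet.iUnion fun n => (hs n).1, s, hs, subset_rfl⟩

theorem isSmall_empty [MeasurableSpace Z] (p : Z → X) : IsSmall p ∅ :=
  ⟨fun _ => ∅, fun _ => ⟨MeasurableSet.empty, injOn_empty p⟩, empty_subset _⟩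

theorem IsSmall.iUnion [MeasurableSpace Z] {p : Z → X} {ι : Type*} [Countable ι] {D : ι → Set Z}
    (h : ∀ i, IsSmall p (D i)) : IsSmall p (⋃ i, D i) := by
  rcases isEmpty_or_nonempty ι with hι | hι
  · simpa using isSmall_empty p
  choose s hs hD using h
  obtain ⟨e, he⟩ := exists_surjective_nat (ι × ℕ)
  refine ⟨fun n => s (e n).1 (e n).2, fun n => hs _ _, iUnion_subset fun i z hz => ?_⟩
  obtain ⟨n, hn⟩ := mem_iUnion.1 (hD i hz)
  obtain ⟨m, hm⟩ := he (i, n)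
  exact mem_iUnion.2 ⟨m, by simpa [hm] using hn⟩

theorem IsSmall.union [MeasurableSpace Z] {p : Z → X} {D D' : Set Z}
    (h : IsSmall p D) (h' : IsSmall p D') : IsSmall p (D ∪ D') := by
  rw [union_eq_iUnion]
  exact IsSmall.iUnion (by rintro (_ | _) <;> assumption)

/-- An analytic set on which `p` is injective is small. -/
theorem IsSmall.of_injOn [MeasurableSpace Z] [StandardBorelSpace Z] [TopologicalSpace X]
    [MeasurableSpace X] [BorelSpace X] [PolishSpace X] {W : Type*} [MeasurableSpace W]
    [StandardBorelSpace W] {p : Z → X} (hp : Measurable p) {q : W → Z} (hq : Measurable q)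
    {C : Set W} (hC : MeasurableSet C) (hinj : InjOn p (q '' C)) : IsSmall p (q '' C) := by
  -- The sets `U n` separate points. Injectivity makes the images of the two halves of `q '' C`
  -- disjoint analytic sets, so a Borel `B n` separates them; `p z` then determines every bit of the
  -- code of `z` on the set where `U n` and `B n` agree.
  let U : ℕ → Set Z := fun n => {z | MeasurableSpace.mapNatBool Z z n = true}
  have hU : ∀ n, MeasurableSet (U n) := fun n =>
    (measurable_pi_apply n).comp (MeasurableSpace.measurable_mapNatBool Z)
      (measurableSet_singleton true)
  have hsep : ∀ n, MeasurablySeparable (p '' (q '' C ∩ U n)) (p '' (q '' C ∩ (U n)ᶜ)) := by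
    intro n
    have key : ∀ V : Set Z, MeasurableSet V → AnalyticSet (p '' (q '' C ∩ V)) := by
      intro V hV
      rw [image_inter_preimage q C V |>.symm, ← image_comp]
      exact (hC.inter (hq hV)).analyticSet_image (hp.comp hq)
    refine (key _ (hU n)).measurablySeparable (key _ (hU n).compl) ?_
    rw [disjoint_left]
    rintro _ ⟨z, ⟨hz, hzU⟩, rfl⟩ ⟨z', ⟨hz', hzU'⟩, h⟩
    exact hzU' (hinj hz' hz h ▸ hzU)
  choose B hB1 hB2 hB3 using hsep
  refine ⟨fun _ => {z | ∀ n, z ∈ U n ↔ p z ∈ B n}, fun _ => ⟨?_, ?_⟩, fun z hz => ?_⟩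
  · exact measurableSet_setOfPred.2 (Measurable.forall fun n =>
      (hU n).mem.iff ((hB3 n).mem.comp hp))
  · intro z hz z' hz' h
    apply MeasurableSpace.injective_mapNatBool Z
    ext n
    have h1 := hz n
    have h2 := hz' n
    rw [h, ← h2] at h1
    have h3 : MeasurableSpace.mapNatBool Z z n = true ↔ MeasurableSpace.mapNatBool Z z' n = true :=
      h1
    cases h4 : MeasurableSpace.mapNatBool Z z n <;> cases h5 : MeasurableSpace.mapNatBool Z z' n <;>
      simp_all
  · refine mem_iUnion.2 ⟨0, fun n => ⟨fun h => hB1 n ⟨z, ⟨hz, h⟩, rfl⟩, fun h => ?_⟩⟩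
    by_contra hzU
    exact disjoint_left.1 (hB2 n) ⟨z, ⟨hz, hzU⟩, rfl⟩ h

/-- A set of configurations is negligible if every member meets a fixed small set. -/
def Negligible [MeasurableSpace Z] (p : Z → X) (C : Set (T → Z)) : Prop :=
  ∃ D, IsSmall p D ∧ ∀ γ ∈ C, ∃ t, γ t ∈ D

theorem Negligible.iUnion [MeasurableSpace Z] {p : Z → X} {ι : Type*} [Countable ι]
    {C : ι → Set (T → Z)} (h : ∀ i, Negligible p (C i)) : Negligible p (⋃ i, C i) := by
  choose D hD hC using h
  refine ⟨⋃ i, D i, IsSmall.iUnion hD, fun γ hγ => ?_⟩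
  obtain ⟨i, hi⟩ := mem_iUnion.1 hγ
  obtain ⟨t, ht⟩ := hC i γ hi
  exact ⟨t, mem_iUnion.2 ⟨i, ht⟩⟩

theorem Negligible.mono [MeasurableSpace Z] {p : Z → X} {C C' : Set (T → Z)}
    (h : Negligible p C) (hC : C' ⊆ C) : Negligible p C' := by
  obtain ⟨D, hD, h⟩ := h
  exact ⟨D, hD, fun γ hγ => h γ (hC hγ)⟩

/-- The sets of configurations in a single fibre that occur in the construction. -/
structure Good [MeasurableSpace Z] (p : Z → X) (C : Set (T → Z)) : Prop where
  measurable : MeasurableSet C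
  not_negligible : ¬ Negligible p C
  const : ∀ γ ∈ C, ∀ t t', p (γ t) = p (γ t')

theorem Good.nonempty [MeasurableSpace Z] {p : Z → X} {C : Set (T → Z)} (h : Good p C) :
    C.Nonempty := by
  rw [nonempty_iff_ne_empty]
  rintro rfl
  exact h.not_negligible ⟨∅, isSmall_empty p, fun _ h => h.elim⟩

/-- If all such pairs met a small set, then among the members of `C` avoiding it, two with values at
`t₀` in the same fibre would have equal values there. Hence `p` would be injective on the analytic
set of these values, which would be small, making `C` negligible. -/
theorem Good.double [MeasurableSpace Z] [StandardBorelSpace Z] [TopologicalSpace X]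
    [MeasurableSpace X] [BorelSpace X] [PolishSpace X] [Finite T] {p : Z → X} (hp : Measurable p)
    {C : Set (T → Z)} (h : Good p C) (t₀ : T) :
    Good p {γ : T × Bool → Z | (∀ b, (fun t => γ (t, b)) ∈ C) ∧
      p (γ (t₀, false)) = p (γ (t₀, true)) ∧ γ (t₀, false) ≠ γ (t₀, true)} where
  measurable := by
    refine measurableSet_setOfPred.2 ((Measurable.forall fun b => h.measurable.mem.comp
      (measurable_pi_lambda (fun (γ : T × Bool → Z) t => γ (t, b))
        fun t => measurable_pi_apply (t, b))).and (Measurable.and ?_ ?_))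
    · exact measurableSet_setOfPred.1 (measurableSet_eq_fun (hp.comp (measurable_pi_apply _))
        (hp.comp (measurable_pi_apply _)))
    · exact (measurableSet_setOfPred.1 (measurableSet_eq_fun (measurable_pi_apply (t₀, false))
        (measurable_pi_apply (t₀, true)))).not
  not_negligible := by
    rintro ⟨D, hD, hC⟩
    -- A Borel enlargement is needed so that the configurations avoiding it form a Borel set, whose
    -- projection is analytic.
    obtain ⟨D', hDD', hD'm, hD'⟩ := hD.exists_measurable
    set S : Set (T → Z) := C ∩ {γ | ∀ t, γ t ∉ D'} with hS
    have hSm : MeasurableSet S := by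
      exact h.measurable.inter (measurableSet_setOfPred.2 (Measurable.forall fun t =>
        (hD'm.mem.comp (measurable_pi_apply t)).not))
    have hsmall : IsSmall p ((fun γ : T → Z => γ t₀) '' S) := by
      refine IsSmall.of_injOn hp (measurable_pi_apply t₀) hSm ?_
      rintro _ ⟨γ, hγ, rfl⟩ _ ⟨γ', hγ', rfl⟩ hpp
      by_contra hne
      obtain ⟨⟨t, b⟩, ht⟩ := hC (fun t => if t.2 then γ' t.1 else γ t.1)
        ⟨by rintro (_ | _) <;> simp [hγ.1, hγ'.1], by simpa using hpp, by simpa using hne⟩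
      cases b
      · exact hγ.2 t (hDD' (by simpa using ht))
      · exact hγ'.2 t (hDD' (by simpa using ht))
    refine h.not_negligible ⟨_, hD'.union hsmall, fun γ hγ => ?_⟩
    by_cases hγD : ∃ t, γ t ∈ D'
    · obtain ⟨t, ht⟩ := hγD
      exact ⟨t, Or.inl ht⟩
    · exact ⟨t₀, Or.inr ⟨γ, ⟨hγ, not_exists.1 hγD⟩, rfl⟩⟩
  const := by
    rintro γ ⟨h1, h2, -⟩
    have key : ∀ t b, p (γ (t, b)) = p (γ (t₀, false)) := by
      intro t b
      rw [show p (γ (t, b)) = p (γ (t₀, b)) from h.const _ (h1 b) t t₀]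
      cases b
      · rfl
      · exact h2.symm
    rintro ⟨t, b⟩ ⟨t', b'⟩
    rw [key t, key t']

/-- Negligible sets are closed under countable unions, so some piece stays non-negligible. -/
theorem Good.exists_of_iUnion [MeasurableSpace Z] {p : Z → X} {C : Set (T → Z)} (h : Good p C)
    {ι : Type*} [Countable ι] (A : ι → Set (T → Z)) (hA : ∀ i, MeasurableSet (A i))
    (hC : C ⊆ ⋃ i, A i) : ∃ i, Good p (C ∩ A i) := by
  by_contra! hcon
  refine h.not_negligible (Negligible.mono (Negligible.iUnion (C := fun i => C ∩ A i) fun i => ?_)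
    (by rw [← inter_iUnion]; exact subset_inter subset_rfl hC))
  by_contra hi
  exact hcon i ⟨h.measurable.inter (hA i), hi, fun γ hγ => h.const γ hγ.1⟩

/-- The doubled set is covered by countably many boxes of closed balls centred on a dense sequence;
one box that keeps it good gives both the diameter bound and the separating closed sets. -/
theorem Good.exists_split [MetricSpace Z] [TopologicalSpace.SeparableSpace Z] [CompleteSpace Z]
    [MeasurableSpace Z] [BorelSpace Z] [TopologicalSpace X]
    [MeasurableSpace X] [BorelSpace X] [PolishSpace X] [Finite T] {p : Z → X} (hp : Measurable p)
    {C : Set (T → Z)} (h : Good p C) (t₀ : T) {ε : ℝ} (hε : 0 < ε) :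
    ∃ C' : Set (T × Bool → Z), Good p C' ∧ (∀ γ ∈ C', ∀ b, (fun t => γ (t, b)) ∈ C) ∧
      (∀ γ ∈ C', ∀ γ' ∈ C', ∀ t, dist (γ t) (γ' t) ≤ ε) ∧
      ∃ U V : Set Z, IsClosed U ∧ IsClosed V ∧ Disjoint U V ∧
        ∀ γ ∈ C', γ (t₀, false) ∈ U ∧ γ (t₀, true) ∈ V := by
  have : SecondCountableTopology Z := UniformSpace.secondCountable_of_separable Z
  have : PolishSpace Z := ⟨⟩
  have : Nonempty Z := by
    obtain ⟨γ, -⟩ := h.nonempty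
    exact ⟨γ t₀⟩
  let d := TopologicalSpace.denseSeq Z
  have hd : ∀ (z : Z) (r : ℝ), 0 < r → ∃ n, z ∈ Metric.closedBall (d n) r := by
    intro z r hr
    obtain ⟨n, hn⟩ := (TopologicalSpace.denseRange_denseSeq Z).exists_dist_lt z hr
    exact ⟨n, hn.le⟩
  have hg := h.double hp t₀
  obtain ⟨⟨s, i, j, k⟩, hs⟩ := hg.exists_of_iUnion (ι := (T × Bool → ℕ) × ℕ × ℕ × ℕ)
    (fun s => {γ | (∀ t, γ t ∈ Metric.closedBall (d (s.1 t)) (ε / 2)) ∧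
      γ (t₀, false) ∈ Metric.closedBall (d s.2.1) (1 / (s.2.2.2 + 1)) ∧
      γ (t₀, true) ∈ Metric.closedBall (d s.2.2.1) (1 / (s.2.2.2 + 1)) ∧
      Disjoint (Metric.closedBall (d s.2.1) (1 / ((s.2.2.2 : ℝ) + 1)))
        (Metric.closedBall (d s.2.2.1) (1 / ((s.2.2.2 : ℝ) + 1)))})
    (fun s => by
      have hb : ∀ (t : T × Bool) (c : Z) (r : ℝ),
          Measurable fun γ : T × Bool → Z => γ t ∈ Metric.closedBall c r := fun t c r =>
        Metric.isClosed_closedBall.measurableSet.mem.comp (measurable_pi_apply t)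
      exact measurableSet_setOfPred.2 ((Measurable.forall fun t => hb _ _ _).and
        ((hb _ _ _).and ((hb _ _ _).and measurable_const))))
    (fun γ hγ => by
      choose s hs using fun t => hd (γ t) (ε / 2) (half_pos hε)
      have hne : 0 < dist (γ (t₀, false)) (γ (t₀, true)) := dist_pos.2 hγ.2.2
      -- A common point of the two balls would join the two values by a path of four segments, each
      -- of length at most `1 / (k + 1)`.
      obtain ⟨k, hk⟩ := exists_nat_one_div_lt (show 0 < dist (γ (t₀, false)) (γ (t₀, true)) / 4 by
        linarith)
      obtain ⟨i, hi⟩ := hd (γ (t₀, false)) _ (Nat.one_div_pos_of_nat (n := k) (α := ℝ))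
      obtain ⟨j, hj⟩ := hd (γ (t₀, true)) _ (Nat.one_div_pos_of_nat (n := k) (α := ℝ))
      refine mem_iUnion.2 ⟨⟨s, i, j, k⟩, hs, hi, hj, ?_⟩
      rw [disjoint_left]
      intro z hz hz'
      rw [Metric.mem_closedBall] at hi hj hz hz'
      have h1 := dist_triangle4 (γ (t₀, false)) (d i) z (d j)
      have h2 := dist_triangle (γ (t₀, false)) (d j) (γ (t₀, true))
      rw [dist_comm (d j)] at h2
      rw [dist_comm (d i)] at h1
      linarith)
  refine ⟨_, hs, fun γ hγ => hγ.1.1, fun γ hγ γ' hγ' t => ?_, _, _, Metric.isClosed_closedBall,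
    Metric.isClosed_closedBall, hs.nonempty.some_mem.2.2.2.2, fun γ hγ => ⟨hγ.2.2.1, hγ.2.2.2.1⟩⟩
  have h1 := hγ.2.1 t
  have h2 := hγ'.2.1 t
  rw [Metric.mem_closedBall] at h1 h2
  have := dist_triangle_right (γ t) (γ' t) (d (s t))
  linarith

/-- The vertices of the `n`-th level of the full binary tree. -/
def Level : ℕ → Type
  | 0 => Unit
  | n + 1 => Level n × Bool

instance finite_level : ∀ n, Finite (Level n)
  | 0 => inferInstanceAs (Finite Unit)
  | n + 1 =>
    have := finite_level n
    inferInstanceAs (Finite (Level n × Bool))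

/-- The vertex of the `n`-th level below a branch. -/
def restr (z : ℕ → Bool) : ∀ n, Level n
  | 0 => ()
  | n + 1 => (restr z n, z n)

theorem restr_congr {z z' : ℕ → Bool} : ∀ n, (∀ i < n, z i = z' i) → restr z n = restr z' n
  | 0, _ => rfl
  | n + 1, h => by
    rw [restr, restr, restr_congr n fun i hi => h i (hi.trans n.lt_succ_self), h n n.lt_succ_self]

/-- Otherwise, repeated splitting gives good sets of configurations on the levels of the binary
tree. Limits along branches define a continuous map of Cantor space into one fibre that
distinguishes the points differing only at coordinate `n` and passing through `t₀ n`. Since the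
fibre is countable, one value is taken on a nonempty open set, which contains such a pair. -/
theorem isSmall_univ_of_countable_fibres [MetricSpace Z] [TopologicalSpace.SeparableSpace Z]
    [CompleteSpace Z] [MeasurableSpace Z] [BorelSpace Z] [TopologicalSpace X]
    [MeasurableSpace X] [BorelSpace X] [PolishSpace X] {p : Z → X} (hp : Continuous p)
    (hc : ∀ x, (p ⁻¹' {x}).Countable) : IsSmall p univ := by
  have : SecondCountableTopology Z := UniformSpace.secondCountable_of_separable Z
  by_contra hns
  have h0 : Good p (univ : Set (Level 0 → Z)) := by
    refine ⟨MeasurableSet.univ, ?_, fun γ _ t t' => rfl⟩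
    rintro ⟨D, hD, hC⟩
    refine hns (hD.mono fun z _ => ?_)
    obtain ⟨t, ht⟩ := hC (fun _ => z) (mem_univ _)
    exact ht
  let d := TopologicalSpace.denseSeq (ℕ → Bool)
  -- By the pairing function, prefixes of each member of the dense sequence are chosen at
  -- arbitrarily high levels.
  let t₀ : ∀ n, Level n := fun n => restr (d (Nat.unpair n).1) n
  choose next hnext hhalf hdist U V hU hV hUV hmem using
    fun (n : ℕ) (C : {C : Set (Level n → Z) // Good p C}) =>
      C.2.exists_split hp.measurable (t₀ n) (pow_pos (one_half_pos (α := ℝ)) n)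
  let C : ∀ n, {C : Set (Level n → Z) // Good p C} := fun n =>
    Nat.rec ⟨univ, h0⟩ (fun n C => ⟨next n C, hnext n C⟩) n
  -- Fixing the bits from `n` to `m - 1` of a level `m` configuration selects a level `n`
  -- configuration that is again in the good set.
  have hpull : ∀ (z : ℕ → Bool) (n m : ℕ), n ≤ m → ∀ γ ∈ (C m).1, ∃ γ' ∈ (C n).1,
      ∀ z' : ℕ → Bool, (∀ k, n ≤ k → z' k = z k) → γ (restr z' m) = γ' (restr z' n) := by
    intro z n m hnm
    induction m, hnm using Nat.le_induction with
    | base => exact fun γ hγ => ⟨γ, hγ, fun _ _ => rfl⟩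
    | succ m hm ih =>
      intro γ hγ
      obtain ⟨γ', hγ', h⟩ := ih _ (hhalf m (C m) γ hγ (z m))
      refine ⟨γ', hγ', fun z' hz' => ?_⟩
      rw [← h z' hz', restr, hz' m hm]
  choose γ hγ using fun n => (C n).2.nonempty
  -- The index is shifted to `n + 1` below because level 0 carries no diameter bound; the bound `(1
  -- / 2) ^ n` first holds at level `n + 1`.
  let ψ' : ℕ → (ℕ → Bool) → Z := fun n z => γ n (restr z n)
  have hψ' : ∀ (z : ℕ → Bool) (n m : ℕ), n ≤ m → dist (ψ' (n + 1) z) (ψ' (m + 1) z) ≤ (1 / 2) ^ n := by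
    intro z n m hnm
    obtain ⟨γ', hγ', h⟩ := hpull z (n + 1) (m + 1) (by omega) _ (hγ (m + 1))
    have := hdist n (C n) _ (hγ (n + 1)) γ' hγ' (restr z (n + 1))
    rw [← h z fun _ _ => rfl] at this
    exact this
  have hlim : ∀ z, ∃ y, Tendsto (fun n => ψ' (n + 1) z) atTop (𝓝 y) := fun z =>
    cauchySeq_tendsto_of_complete (cauchySeq_of_le_tendsto_0' _ (hψ' z)
      (tendsto_pow_atTop_nhds_zero_of_lt_one (by norm_num) (by norm_num)))
  choose ψ hψ using hlim
  have hψd : ∀ z n, dist (ψ' (n + 1) z) (ψ z) ≤ (1 / 2) ^ n := fun z n =>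
    le_of_tendsto (tendsto_const_nhds.dist (hψ z))
      (eventually_atTop.2 ⟨n, fun m hm => hψ' z n m hm⟩)
  have hψc : Continuous ψ := by
    rw [continuous_iff_continuousAt]
    intro z
    rw [ContinuousAt, Metric.tendsto_nhds]
    intro ε hε
    obtain ⟨n, hn⟩ := exists_pow_lt_of_lt_one (half_pos hε) (show (1 / 2 : ℝ) < 1 by norm_num)
    have hev : ∀ᶠ z' in 𝓝 z, ∀ i ∈ Finset.range (n + 1), z' i = z i := by
      rw [Filter.eventually_all_finset]
      intro i _
      exact (continuous_apply i).continuousAt.eventually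
        ((isOpen_discrete {z i}).mem_nhds rfl)
    filter_upwards [hev] with z' hz'
    have heq : ψ' (n + 1) z' = ψ' (n + 1) z :=
      congrArg (γ (n + 1)) (restr_congr _ fun i hi => hz' i (Finset.mem_range.2 hi))
    have h1 := hψd z n
    have h2 := hψd z' n
    rw [heq] at h2
    have := dist_triangle_left (ψ z') (ψ z) (ψ' (n + 1) z)
    linarith
  have hfib : ∀ z z', p (ψ z) = p (ψ z') := fun z z' =>
    tendsto_nhds_unique ((hp.tendsto _).comp (hψ z))
      (((hp.tendsto _).comp (hψ z')).congr fun n => (C (n + 1)).2.const _ (hγ (n + 1)) _ _)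
  have hedge : ∀ n z, restr z n = t₀ n →
      ψ (Function.update z n false) ≠ ψ (Function.update z n true) := by
    intro n z hz
    have hr : ∀ b, restr (Function.update z n b) (n + 1) = (t₀ n, b) := by
      intro b
      rw [restr, ← hz, Function.update_self, restr_congr n]
      intro i hi
      rw [Function.update_of_ne hi.ne]
    have key : ∀ m ≥ n, ψ' (m + 1) (Function.update z n false) ∈ U n (C n) ∧
        ψ' (m + 1) (Function.update z n true) ∈ V n (C n) := by
      intro m hm
      obtain ⟨γ', hγ', h⟩ := hpull z (n + 1) (m + 1) (by omega) _ (hγ (m + 1))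
      have hb : ∀ b, ψ' (m + 1) (Function.update z n b) = γ' (t₀ n, b) := by
        intro b
        rw [← hr b]
        exact h _ fun k hk => Function.update_of_ne (by omega) _ _
      rw [hb, hb]
      exact hmem n (C n) γ' hγ'
    have h1 : ψ (Function.update z n false) ∈ U n (C n) :=
      (hU n (C n)).mem_of_tendsto (hψ _) (eventually_atTop.2 ⟨n, fun m hm => (key m hm).1⟩)
    have h2 : ψ (Function.update z n true) ∈ V n (C n) :=
      (hV n (C n)).mem_of_tendsto (hψ _) (eventually_atTop.2 ⟨n, fun m hm => (key m hm).2⟩)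
    intro he
    exact disjoint_left.1 (hUV n (C n)) h1 (he ▸ h2)
  let z₀ : ℕ → Bool := fun _ => true
  have := (hc (p (ψ z₀))).to_subtype
  -- Baire category: the closed preimages of the countably many points of the fibre cover Cantor
  -- space.
  obtain ⟨c, w, hw⟩ := nonempty_interior_of_iUnion_of_closed
    (f := fun c : p ⁻¹' {p (ψ z₀)} => ψ ⁻¹' {c.1}) (fun c => isClosed_singleton.preimage hψc)
    (eq_univ_of_forall fun z => mem_iUnion.2 ⟨⟨ψ z, hfib z z₀⟩, rfl⟩)
  obtain ⟨k, hk⟩ := (TopologicalSpace.denseRange_denseSeq (ℕ → Bool)).exists_mem_open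
    isOpen_interior ⟨w, hw⟩
  obtain ⟨I, u, hu, hsub⟩ := isOpen_pi_iff.1 isOpen_interior _ hk
  obtain ⟨N, hN⟩ := I.exists_nat_subset_range
  -- The open set contains a basic neighbourhood of `d k` that constrains only coordinates below
  -- `N`, so changing coordinate `n ≥ N` of `d k` stays inside it.
  have hn : N ≤ Nat.pair k N := Nat.right_le_pair k N
  set n := Nat.pair k N with hndef
  have hdk : t₀ n = restr (d k) n := by simp [t₀, hndef]
  have hb : ∀ b, ψ (Function.update (d k) n b) = c := fun b => by
    refine mem_singleton_iff.1 (interior_subset (s := ψ ⁻¹' {c.1}) (hsub fun i hi => ?_))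
    rw [Function.update_of_ne]
    · exact (hu i hi).2
    · have := Finset.mem_range.1 (hN hi)
      omega
  exact hedge n (d k) hdk.symm ((hb false).trans (hb true).symm)

/-- **Lusin–Novikov**: the domain of a countable-to-one Borel map between standard Borel spaces is a
countable union of Borel sets on which the map is injective. -/
theorem exists_cover_injOn {X Z : Type*} [MeasurableSpace X] [StandardBorelSpace X]
    [MeasurableSpace Z] [StandardBorelSpace Z] {p : Z → X} (hp : Measurable p)
    (hc : ∀ x, (p ⁻¹' {x}).Countable) :
    ∃ s : ℕ → Set Z, (∀ n, MeasurableSet (s n) ∧ InjOn p (s n)) ∧ ⋃ n, s n = univ := by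
  let := upgradeStandardBorel X
  obtain ⟨t', hb', ht'⟩ := ‹StandardBorelSpace Z›.polish
  -- Refining the Polish topology of the domain makes `p` continuous without changing the Borel
  -- sets.
  obtain ⟨t, ht, hpc, htp⟩ := hp.exists_continuous
  have hb : @BorelSpace Z t _ :=
    @BorelSpace.mk Z t _ (hb'.measurable_eq.trans (borel_eq_borel_of_le htp ht' ht).symm)
  clear ht hb' ht'
  clear t'
  let := TopologicalSpace.upgradeIsCompletelyMetrizable Z
  obtain ⟨s, hs, h⟩ := isSmall_univ_of_countable_fibres hpc hc
  exact ⟨s, hs, univ_subset_iff.1 h⟩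

end LusinNovikov

namespace CBER

/-! ### Borel enumerations of the classes -/

/-- Lusin–Novikov, applied to the first projection of the relation, covers it by countably many
Borel graphs of partial functions; each is completed by the identity off its domain. -/
theorem exists_enum (E : CBER) : ∃ g : ℕ → E.carrier → E.carrier, (∀ n, Measurable (g n)) ∧
    (∀ x, g 0 x = x) ∧ ∀ x y, E.rel x y ↔ ∃ n, g n x = y := by
  classical
  let R := {p : E.carrier × E.carrier | E.rel p.1 p.2}
  have : StandardBorelSpace R := E.measurable_rel.standardBorel
  let p : R → E.carrier := fun z => z.1.1
  have hp : Measurable p := measurable_fst.comp measurable_subtype_coe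
  obtain ⟨s, hs, hcov⟩ := LusinNovikov.exists_cover_injOn hp (fun x => by
    have hinj : InjOn (fun z : R => z.1.2) (p ⁻¹' {x}) := fun z hz z' hz' h =>
      Subtype.ext (Prod.ext ((hz : z.1.1 = x).trans (hz' : z'.1.1 = x).symm) h)
    refine MapsTo.countable_of_injOn (t := {y | E.rel x y}) ?_ hinj (E.countable_class x)
    rintro z rfl
    exact z.2)
  let g : ℕ → E.carrier → E.carrier := fun n x =>
    if h : ∃ z ∈ s n, p z = x then h.choose.1.2 else x
  have hg1 : ∀ n z, z ∈ s n → g n z.1.1 = z.1.2 := by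
    intro n z hz
    have h : ∃ z' ∈ s n, p z' = z.1.1 := ⟨z, hz, rfl⟩
    simp only [g, dif_pos h]
    rw [(hs n).2 h.choose_spec.1 hz h.choose_spec.2]
  have hg2 : ∀ n x, x ∉ p '' s n → g n x = x := by
    intro n x hx
    exact dif_neg hx
  -- Index 0 is reserved for the identity, so the partial functions are shifted by one.
  refine ⟨fun n => n.casesOn id g, ?_, fun _ => rfl, fun x y => ⟨fun h => ?_, ?_⟩⟩
  · rintro (_ | n)
    · exact measurable_id
    intro U hU
    -- The images are Borel because `p` is injective on `s n`.
    have : g n ⁻¹' U = p '' (s n ∩ {z | z.1.2 ∈ U}) ∪ ((p '' s n)ᶜ ∩ U) := by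
      ext x
      by_cases hx : x ∈ p '' s n
      · obtain ⟨z, hz, rfl⟩ := hx
        rw [mem_preimage, show p z = z.1.1 from rfl, hg1 n z hz]
        constructor
        · exact fun h => Or.inl ⟨z, ⟨hz, h⟩, rfl⟩
        · rintro (⟨z', ⟨hz', h⟩, he⟩ | ⟨h, -⟩)
          · rwa [(hs n).2 hz' hz he] at h
          · exact (h ⟨z, hz, rfl⟩).elim
      · rw [mem_preimage, hg2 n x hx]
        constructor
        · exact fun h => Or.inr ⟨hx, h⟩
        · rintro (⟨z', ⟨hz', h⟩, rfl⟩ | ⟨-, h⟩)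
          · exact (hx ⟨z', hz', rfl⟩).elim
          · exact h
    change MeasurableSet (g n ⁻¹' U)
    rw [this]
    refine MeasurableSet.union ?_ (MeasurableSet.inter ?_ hU)
    · exact ((hs n).1.inter ((measurable_snd.comp measurable_subtype_coe) hU)
        ).image_of_measurable_injOn hp ((hs n).2.mono inter_subset_left)
    · exact ((hs n).1.image_of_measurable_injOn hp (hs n).2).compl
  · obtain ⟨n, hn⟩ := mem_iUnion.1 (hcov.ge (mem_univ (⟨(x, y), h⟩ : R)))
    exact ⟨n + 1, hg1 n _ hn⟩
  · rintro ⟨_ | n, rfl⟩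
    · exact E.equivalence.refl x
    · by_cases hx : x ∈ p '' s n
      · obtain ⟨z, hz, rfl⟩ := hx
        change E.rel z.1.1 (g n z.1.1)
        rw [hg1 n z hz]
        exact z.2
      · change E.rel x (g n x)
        rw [hg2 n x hx]
        exact E.equivalence.refl x

/-- A sequence of Borel maps enumerating the class of each point. -/
noncomputable def enum (E : CBER) : ℕ → E.carrier → E.carrier := E.exists_enum.choose

theorem measurable_enum (E : CBER) (n : ℕ) : Measurable (E.enum n) :=
  E.exists_enum.choose_spec.1 n

theorem enum_zero (E : CBER) (x : E.carrier) : E.enum 0 x = x := E.exists_enum.choose_spec.2.1 x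

theorem rel_iff_enum (E : CBER) {x y : E.carrier} : E.rel x y ↔ ∃ n, E.enum n x = y :=
  E.exists_enum.choose_spec.2.2 x y

theorem rel_enum (E : CBER) (n : ℕ) (x : E.carrier) : E.rel x (E.enum n x) :=
  E.rel_iff_enum.2 ⟨n, rfl⟩

theorem rel_refl (E : CBER) (x : E.carrier) : E.rel x x := E.equivalence.refl x

theorem rel_symm (E : CBER) {x y : E.carrier} (h : E.rel x y) : E.rel y x := E.equivalence.symm h

theorem rel_trans (E : CBER) {x y z : E.carrier} (h : E.rel x y) (h' : E.rel y z) : E.rel x z :=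
  E.equivalence.trans h h'

theorem measurable_rel_comp (E : CBER) {W : Type*} [MeasurableSpace W] {f g : W → E.carrier}
    (hf : Measurable f) (hg : Measurable g) : Measurable fun w => E.rel (f w) (g w) :=
  (E.measurable_rel.mem.comp (hf.prodMk hg) :)

/-- A selfmap that moves points within their classes is Borel if its graph is. -/
theorem measurable_of_measurable_eq_enum (E : CBER) {k : E.carrier → E.carrier}
    (hk : ∀ x, E.rel x (k x)) (h : ∀ n, Measurable fun x => k x = E.enum n x) :
    Measurable k := by
  intro U hU
  have : k ⁻¹' U = ⋃ n, {x | k x = E.enum n x} ∩ E.enum n ⁻¹' U := by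
    ext x
    simp only [mem_preimage, mem_iUnion, mem_inter_iff]
    constructor
    · intro hx
      obtain ⟨n, hn⟩ := E.rel_iff_enum.1 (hk x)
      exact ⟨n, hn.symm, hn.symm ▸ hx⟩
    · rintro ⟨n, hn : k x = _, hx⟩
      rwa [hn]
  rw [this]
  exact MeasurableSet.iUnion fun n => (h n).setOf.inter (E.measurable_enum n hU)

/-! ### Class-bijective homomorphisms -/

theorem IsClassBijective.of_forall {E F : CBER} {f : E.carrier → F.carrier} (hm : Measurable f)
    (hr : ∀ x y, E.rel x y → F.rel (f x) (f y)) (hi : ∀ x y, E.rel x y → f x = f y → x = y)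
    (hs : ∀ x y, F.rel (f x) y → ∃ x', E.rel x x' ∧ f x' = y) : IsClassBijective E F f :=
  ⟨hm, hr, fun x => ⟨fun y hy => hr x y hy,
    fun y hy z hz h => hi y z (E.rel_trans (E.rel_symm hy) hz) h, fun y hy => hs x y hy⟩⟩

theorem IsClassBijective.eq_of_rel {E F : CBER} {f : E.carrier → F.carrier}
    (hf : IsClassBijective E F f) {x y : E.carrier} (h : E.rel x y) (he : f x = f y) : x = y :=
  (hf.bijOn x).injOn (E.rel_refl x) h he

theorem IsClassBijective.exists_rel {E F : CBER} {f : E.carrier → F.carrier}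
    (hf : IsClassBijective E F f) {x : E.carrier} {y : F.carrier} (h : F.rel (f x) y) :
    ∃ x', E.rel x x' ∧ f x' = y :=
  (hf.bijOn x).surjOn h

theorem IsClassBijective.id (E : CBER) : IsClassBijective E E id :=
  .of_forall measurable_id (fun _ _ h => h) (fun _ _ _ h => h) fun _ y h => ⟨y, h, rfl⟩

theorem IsClassBijective.comp {E F G : CBER} {g : F.carrier → G.carrier} {f : E.carrier → F.carrier}
    (hg : IsClassBijective F G g) (hf : IsClassBijective E F f) : IsClassBijective E G (g ∘ f) := by
  refine .of_forall (hg.measurable.comp hf.measurable)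
    (fun x y h => hg.map_rel _ _ (hf.map_rel _ _ h))
    (fun x y h he => hf.eq_of_rel h (hg.eq_of_rel (hf.map_rel _ _ h) he)) fun x z h => ?_
  obtain ⟨y, hy, rfl⟩ := hg.exists_rel h
  obtain ⟨x', hx, rfl⟩ := hf.exists_rel hy
  exact ⟨x', hx, rfl⟩

theorem IsInvariantEmbedding.isClassBijective {E F : CBER} {f : E.carrier → F.carrier}
    (hf : IsInvariantEmbedding E F f) : IsClassBijective E F f := by
  refine .of_forall hf.measurable (fun x y => (hf.map_rel_iff x y).2)
    (fun x y _ h => hf.injective h) fun x z h => ?_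
  obtain ⟨y, rfl⟩ := hf.invariant_range _ _ h
  exact ⟨y, (hf.map_rel_iff x y).1 h, rfl⟩

theorem IsClassBijective.isInvariantEmbedding {E F : CBER} {f : E.carrier → F.carrier}
    (hf : IsClassBijective E F f) (hi : Function.Injective f) : IsInvariantEmbedding E F f := by
  refine ⟨hf.measurable, hi, fun x y => ⟨fun h => ?_, hf.map_rel x y⟩, fun x y h => ?_⟩
  · obtain ⟨x', hx, he⟩ := hf.exists_rel h
    exact hi he ▸ hx
  · obtain ⟨x', -, he⟩ := hf.exists_rel h
    exact ⟨x', he⟩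

/-- Every equivalence relation with a class-bijective homomorphism to `E` invariantly embeds
into `E`. -/
def Absorbing (E : CBER) : Prop := ∀ F : CBER, (∃ f, IsClassBijective F E f) → InvEmbeds F E

/-! ### Restrictions and sums -/

/-- The restriction of `E` to a Borel set. -/
def restrict (E : CBER) (S : Set E.carrier) (hS : MeasurableSet S) : CBER where
  carrier := S
  standardBorel := hS.standardBorel
  rel x y := E.rel x y
  equivalence := ⟨fun _ => E.rel_refl _, E.rel_symm, E.rel_trans⟩
  measurable_rel := (E.measurable_rel_comp (measurable_subtype_coe.comp measurable_fst)
    (measurable_subtype_coe.comp measurable_snd)).setOf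
  countable_class x := (E.countable_class x).preimage Subtype.val_injective

theorem isInvariantEmbedding_val (E : CBER) (S : Set E.carrier) (hS : MeasurableSet S)
    (hinv : ∀ x y, E.rel x y → x ∈ S → y ∈ S) :
    IsInvariantEmbedding (E.restrict S hS) E Subtype.val :=
  ⟨measurable_subtype_coe, Subtype.val_injective, fun _ _ => Iff.rfl,
    fun x y h => ⟨⟨y, hinv x.1 y h x.2⟩, rfl⟩⟩

section Sum

variable {ι : Type} [Countable ι] {E : ι → CBER}

/-- The inclusion of a summand. -/
def sumMk (E : ι → CBER) (i : ι) (x : (E i).carrier) : (sum E).carrier := ⟨i, x⟩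

/-- The index of the summand of a point. -/
def sumFst (p : (sum E).carrier) : ι := Sigma.fst p

theorem sumFst_sumMk (i : ι) (x : (E i).carrier) : sumFst (sumMk E i x) = i := rfl

theorem exists_sumMk (p : (sum E).carrier) : ∃ x, sumMk E (sumFst p) x = p := ⟨p.2, rfl⟩

theorem sumMk_injective (i : ι) : Function.Injective (sumMk E i) :=
  sigma_mk_injective (β := fun i => (E i).carrier)

theorem sum_rel_mk {i : ι} {x y : (E i).carrier} :
    (sum E).rel (sumMk E i x) (sumMk E i y) ↔ (E i).rel x y := by
  constructor
  · rintro ⟨j, x', y', h, h1, h2⟩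
    cases h1
    cases h2
    exact h
  · exact fun h => ⟨i, x, y, h, rfl, rfl⟩

theorem sum_rel_fst {p q : (sum E).carrier} (h : (sum E).rel p q) : sumFst p = sumFst q := by
  obtain ⟨i, x, y, -, rfl, rfl⟩ := h
  rfl

theorem measurable_sumMk (i : ι) :
    Measurable (sumMk E i) := fun _ hs =>
  (MeasurableSpace.measurableSet_iInf.1 hs) i

theorem measurable_of_sumMk {W : Type*} [MeasurableSpace W] {f : (sum E).carrier → W}
    (hf : ∀ i, Measurable fun x => f (sumMk E i x)) : Measurable f := fun _ hs =>
  MeasurableSpace.measurableSet_iInf.2 fun i => hf i hs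

theorem isInvariantEmbedding_mk (i : ι) :
    IsInvariantEmbedding (E i) (sum E) (sumMk E i) where
  measurable := measurable_sumMk i
  injective := sumMk_injective i
  map_rel_iff _ _ := sum_rel_mk
  invariant_range := by
    rintro x ⟨j, y⟩ h
    obtain rfl : i = j := sum_rel_fst h
    exact ⟨y, rfl⟩

theorem measurableSet_fst_eq (i : ι) : MeasurableSet {p : (sum E).carrier | sumFst p = i} := by
  refine Measurable.setOf (measurable_of_sumMk fun j => ?_)
  simp only [sumFst_sumMk]
  exact measurable_const

theorem isClassBijective_sumDesc {K : CBER} {q : ∀ i, (E i).carrier → K.carrier}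
    (hq : ∀ i, IsClassBijective (E i) K (q i)) :
    IsClassBijective (sum E) K fun p => q (sumFst p) p.2 := by
  refine .of_forall (measurable_of_sumMk fun i => (hq i).measurable) ?_ ?_ ?_
  · rintro _ _ ⟨i, x, y, h, rfl, rfl⟩
    exact (hq i).map_rel _ _ h
  · rintro _ _ ⟨i, x, y, h, rfl, rfl⟩ he
    rw [(hq i).eq_of_rel h he]
  · rintro ⟨i, x⟩ y h
    obtain ⟨x', hx, rfl⟩ := (hq i).exists_rel h
    exact ⟨sumMk E i x', sum_rel_mk.2 hx, rfl⟩

variable {F : CBER} {c : F.carrier → ι} {hc : ∀ i, MeasurableSet {x | c x = i}}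

/-- Class-bijective homomorphisms defined on the pieces of a countable invariant Borel partition
combine to one into the sum. -/
theorem isClassBijective_glue (hinv : ∀ x y, F.rel x y → c x = c y)
    {f : ∀ i, (F.restrict _ (hc i)).carrier → (E i).carrier}
    (hf : ∀ i, IsClassBijective (F.restrict _ (hc i)) (E i) (f i)) :
    IsClassBijective F (sum E) fun x => sumMk E (c x) (f (c x) ⟨x, rfl⟩) := by
  -- This replaces the dependent index `c x` by a fixed `i`, so that related points can be compared
  -- in the same summand.
  have key : ∀ x i (h : c x = i), sumMk E (c x) (f (c x) ⟨x, rfl⟩) = sumMk E i (f i ⟨x, h⟩) := by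
    rintro x _ rfl
    rfl
  refine .of_forall (fun s hs => ?_) ?_ ?_ ?_
  · have : (fun x => sumMk E (c x) (f (c x) ⟨x, rfl⟩)) ⁻¹' s =
        ⋃ i, Subtype.val '' (f i ⁻¹' (sumMk E i ⁻¹' s)) := by
      ext x
      simp only [mem_preimage, mem_iUnion, mem_image]
      constructor
      · exact fun h => ⟨c x, ⟨x, rfl⟩, h, rfl⟩
      · rintro ⟨i, ⟨x, hx⟩, h, rfl⟩
        rwa [key x i hx]
    rw [this]
    exact MeasurableSet.iUnion fun i => (MeasurableEmbedding.subtype_coe (hc i)).measurableSet_image'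
      ((hf i).measurable (measurable_sumMk i hs))
  · intro x y h
    rw [key x _ (hinv x y h)]
    exact sum_rel_mk.2 ((hf _).map_rel ⟨x, _⟩ ⟨y, _⟩ h)
  · intro x y h he
    rw [key x _ (hinv x y h)] at he
    exact congrArg Subtype.val ((hf _).eq_of_rel (x := ⟨x, hinv x y h⟩) (y := ⟨y, rfl⟩) h
      (sumMk_injective _ he))
  · rintro x ⟨i, y⟩ h
    obtain rfl : c x = i := sum_rel_fst h
    obtain ⟨⟨x', hx'⟩, hx, rfl⟩ := (hf _).exists_rel (x := ⟨x, rfl⟩) (sum_rel_mk.1 h)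
    exact ⟨x', hx, key x' _ hx'⟩

theorem isInvariantEmbedding_glue (hinv : ∀ x y, F.rel x y → c x = c y)
    {f : ∀ i, (F.restrict _ (hc i)).carrier → (E i).carrier}
    (hf : ∀ i, IsInvariantEmbedding (F.restrict _ (hc i)) (E i) (f i)) :
    IsInvariantEmbedding F (sum E) fun x => sumMk E (c x) (f (c x) ⟨x, rfl⟩) := by
  refine (isClassBijective_glue hinv fun i => (hf i).isClassBijective).isInvariantEmbedding ?_
  intro x y h
  have h1 : c x = c y := congrArg sumFst h
  have key : ∀ x i (h : c x = i), sumMk E (c x) (f (c x) ⟨x, rfl⟩) = sumMk E i (f i ⟨x, h⟩) := by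
    rintro x _ rfl
    rfl
  simp only [key x _ h1] at h
  exact congrArg Subtype.val ((hf _).injective (sumMk_injective _ h))

/-- The piece of a class-bijective homomorphism into a sum over one of the summands. -/
theorem exists_isClassBijective_fibre {f : F.carrier → (sum E).carrier}
    (hf : IsClassBijective F (sum E) f) (i : ι) (hc : MeasurableSet {x | sumFst (f x) = i}) :
    ∃ g : (F.restrict _ hc).carrier → (E i).carrier,
      IsClassBijective (F.restrict _ hc) (E i) g ∧ ∀ x, sumMk E i (g x) = f x.1 := by
  have : ∀ x : (F.restrict _ hc).carrier, ∃ y, sumMk E i y = f x.1 := by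
    rintro ⟨x, rfl⟩
    exact exists_sumMk (f x)
  choose g hg using this
  refine ⟨g, .of_forall ?_ ?_ ?_ ?_, hg⟩
  · intro s hs
    have : g ⁻¹' s = Subtype.val ⁻¹' (f ⁻¹' (sumMk E i '' s)) := by
      ext x
      change g x ∈ s ↔ f x.1 ∈ sumMk E i '' s
      rw [← hg x, (sumMk_injective i).mem_set_image]
    rw [this]
    exact measurable_subtype_coe (hf.measurable
      (((measurable_sumMk i).measurableEmbedding (sumMk_injective i)).measurableSet_image' hs))
  · intro x y h
    have := hf.map_rel _ _ h
    rwa [← hg, ← hg, sum_rel_mk] at this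
  · intro x y h he
    refine Subtype.ext (hf.eq_of_rel h ?_)
    rw [← hg, ← hg, he]
  · intro x y h
    rw [← sum_rel_mk, hg] at h
    obtain ⟨x', hx, he⟩ := hf.exists_rel h
    refine ⟨⟨x', congrArg sumFst he⟩, hx, ?_⟩
    exact sumMk_injective i ((hg _).trans he)

theorem measurableSet_fibre {f : F.carrier → (sum E).carrier}
    (hf : IsClassBijective F (sum E) f) (i : ι) : MeasurableSet {x | sumFst (f x) = i} :=
  hf.measurable (measurableSet_fst_eq i)

theorem fst_eq_of_rel {f : F.carrier → (sum E).carrier} (hf : IsClassBijective F (sum E) f)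
    (x y : F.carrier) (h : F.rel x y) : sumFst (f x) = sumFst (f y) :=
  sum_rel_fst (hf.map_rel _ _ h)

/-- A class-bijective map into the sum cuts its source into invariant Borel pieces, one over each
summand, and each piece is absorbed separately. -/
theorem Absorbing.sum (hE : ∀ i, (E i).Absorbing) : (sum E).Absorbing := by
  rintro F ⟨f, hf⟩
  have : ∀ i, InvEmbeds (F.restrict _ (measurableSet_fibre hf i)) (E i) := fun i => by
    obtain ⟨g, hg, -⟩ := exists_isClassBijective_fibre hf i (measurableSet_fibre hf i)
    exact hE i _ ⟨g, hg⟩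
  choose g hg using this
  exact ⟨_, isInvariantEmbedding_glue (fst_eq_of_rel hf) hg⟩

end Sum

end CBER

/-! ### Structurability and class-bijective homomorphisms -/

theorem InfFormula.realize_equiv {L : FirstOrder.Language.{0, 0}} {M N : Type} {A : L.Structure M}
    {B : L.Structure N} (e : M ≃ N)
    (h : ∀ (k : ℕ) (R : L.Relations k) v, A.RelMap R v ↔ B.RelMap R (e ∘ v)) {n : ℕ}
    (φ : InfFormula L n) (v : Fin n → M) : φ.Realize A v ↔ φ.Realize B (e ∘ v) := by
  induction φ with
  | falsum => exact Iff.rfl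
  | equal i j => exact e.injective.eq_iff.symm
  | rel R w => exact h _ R _
  | imp φ ψ h₁ h₂ => exact imp_congr (h₁ v) (h₂ v)
  | conj φ ih => exact forall_congr' fun m => ih m v
  | all φ ih =>
    refine e.forall_congr fun {a} => ?_
    rw [ih, Fin.comp_snoc]

/-- The language of countably many unary predicates. -/
def unaryLanguage : FirstOrder.Language.{0, 0} := ⟨fun _ => Empty, fun n => {_k : ℕ // n = 1}⟩

theorem isRelational_unaryLanguage : unaryLanguage.IsRelational :=
  fun _ => inferInstanceAs (IsEmpty Empty)

/-- The `k`-th unary predicate. -/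
def unaryPred (k : ℕ) : unaryLanguage.Relations 1 := ⟨k, rfl⟩

open Classical in
/-- The sequence of truth values of the unary predicates at a point. -/
noncomputable def unaryType {M : Type} (A : unaryLanguage.Structure M) (a : M) (k : ℕ) : Bool :=
  decide (A.RelMap (unaryPred k) fun _ => a)

theorem InfFormula.realize_imp_falsum {L : FirstOrder.Language.{0, 0}} {M : Type}
    {A : L.Structure M} {n : ℕ} {φ : InfFormula L n} {v : Fin n → M} :
    (φ.imp .falsum).Realize A v ↔ ¬ φ.Realize A v := Iff.rfl

/-- Borel conditions on the truth values of unary predicates are definable. -/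
theorem exists_formula_of_measurableSet {n : ℕ} {B : Set (Fin n → ℕ → Bool)}
    (hB : MeasurableSet B) : ∃ φ : InfFormula unaryLanguage n, ∀ (M : Type)
      (A : unaryLanguage.Structure M) (v : Fin n → M),
      φ.Realize A v ↔ (fun i => unaryType A (v i)) ∈ B := by
  -- The definable sets form a σ-algebra that makes all coordinates measurable.
  let m : MeasurableSpace (Fin n → ℕ → Bool) :=
    { MeasurableSet' := fun B => ∃ φ : InfFormula unaryLanguage n, ∀ (M : Type)
        (A : unaryLanguage.Structure M) (v : Fin n → M),
        φ.Realize A v ↔ (fun i => unaryType A (v i)) ∈ B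
      measurableSet_empty := ⟨.falsum, fun _ _ _ => Iff.rfl⟩
      measurableSet_compl := by
        rintro s ⟨φ, h⟩
        exact ⟨φ.imp .falsum, fun M A v => not_congr (h M A v)⟩
      measurableSet_iUnion := by
        intro s hs
        choose φ h using hs
        refine ⟨(InfFormula.conj fun i => (φ i).imp .falsum).imp .falsum, fun M A v => ?_⟩
        rw [InfFormula.realize_imp_falsum, mem_iUnion, ← not_forall_not]
        exact not_congr (forall_congr' fun i => not_congr (h i M A v)) }
  have hle : MeasurableSpace.pi ≤ m := by
    have : @Measurable _ _ m MeasurableSpace.pi (id : (Fin n → ℕ → Bool) → _) := by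
      refine @measurable_pi_lambda _ _ _ m _ _ fun i => @measurable_pi_lambda _ _ _ m _ _ fun k =>
        @measurable_to_bool _ m _ ⟨.rel (unaryPred k) fun _ => i, fun M A v => ?_⟩
      simp [InfFormula.Realize, unaryType]
    exact fun s hs => this hs
  exact hle B hB

namespace CBER

/-- The structure is pulled back along `f`. The added conjunct keeps tuples inside one class and is
automatic there, so `f` is an isomorphism of structures on each class. -/
theorem Structurable.of_isClassBijective {E F : CBER} {σ : InfTheory} (h : E.Structurable σ)
    {f : F.carrier → E.carrier} (hf : IsClassBijective F E f) : F.Structurable σ := by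
  obtain ⟨A, hA⟩ := h
  refine ⟨{ funMap := fun g => ((σ.isRelational _).false g).elim
            RelMap := fun R v => A.RelMap R (f ∘ v) ∧ ∀ i j, F.rel (v i) (v j) }, ?_, ?_, ?_⟩
  · intro n R
    refine Measurable.setOf (((hA.measurable n R).mem.comp (g := (· ∈ {v | A.RelMap R v}))
      (f := fun v : Fin n → F.carrier => f ∘ v) ?_).and
      (Measurable.forall fun i => Measurable.forall fun j => F.measurable_rel_comp
        (measurable_pi_apply i) (measurable_pi_apply j)))
    exact measurable_pi_lambda _ fun i => hf.measurable.comp (measurable_pi_apply i)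
  · exact fun n R v h => h.2
  · intro x
    have := hA.realize (f x)
    rw [Subsingleton.elim Fin.elim0 (BijOn.equiv f (hf.bijOn x) ∘ Fin.elim0)] at this
    refine (InfFormula.realize_equiv (BijOn.equiv f (hf.bijOn x)) (fun k R v => ?_) _ _).2 this
    exact and_iff_left fun i j => F.rel_trans (F.rel_symm (v i).2) (v j).2

theorem UniversallyStructurable.absorbing {E : CBER} (h : E.UniversallyStructurable) :
    E.Absorbing := by
  obtain ⟨σ, hE, hσ⟩ := h
  rintro F ⟨f, hf⟩
  exact hσ F (Structurable.of_isClassBijective hE hf)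

/-- A Borel injection of the underlying space into Cantor space. -/
noncomputable def code (E : CBER) : E.carrier → ℕ → Bool := MeasurableSpace.mapNatBool E.carrier

theorem measurableEmbedding_code (E : CBER) : MeasurableEmbedding E.code :=
  (MeasurableSpace.measurable_mapNatBool E.carrier).measurableEmbedding
    (MeasurableSpace.injective_mapNatBool E.carrier)

theorem code_injective (E : CBER) : Function.Injective E.code :=
  MeasurableSpace.injective_mapNatBool E.carrier

/-- The code is an injective Borel map, so the image of a Borel relation is Borel and hence
definable. -/
theorem exists_formula_rel (E : CBER) (r : E.carrier → E.carrier → Prop)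
    (hr : MeasurableSet {p : E.carrier × E.carrier | r p.1 p.2}) :
    ∃ φ : InfFormula unaryLanguage 2, ∀ (M : Type) (A : unaryLanguage.Structure M) (a b : M),
      φ.Realize A (Fin.snoc (Fin.snoc Fin.elim0 a) b) ↔
        ∃ x y, r x y ∧ E.code x = unaryType A a ∧ E.code y = unaryType A b := by
  obtain ⟨φ, hφ⟩ := exists_formula_of_measurableSet
    (B := (fun v : Fin 2 → ℕ → Bool => (v 0, v 1)) ⁻¹'
      (Prod.map E.code E.code '' {p | r p.1 p.2}))
    (((measurable_pi_apply 0).prodMk (measurable_pi_apply 1))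
      ((E.measurableEmbedding_code.prodMap E.measurableEmbedding_code).measurableSet_image' hr))
  refine ⟨φ, fun M A a b => (hφ M A _).trans ?_⟩
  simp only [mem_preimage, mem_image, Prod.exists, Prod.map_apply, Prod.mk.injEq]
  exact Iff.rfl

/-- The equivalence relations with a class-bijective homomorphism to `E` form an elementary class. -/
theorem exists_theory (E : CBER) :
    ∃ σ : InfTheory, ∀ F : CBER, F.Structurable σ ↔ ∃ f, IsClassBijective F E f := by
  obtain ⟨ρ, hρ⟩ := E.exists_formula_rel E.rel E.measurable_rel
  obtain ⟨ε, hε⟩ := E.exists_formula_rel Eq (measurableSet_eq_fun measurable_fst measurable_snd)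
  choose η hη using fun n => E.exists_formula_rel (fun x y => E.enum n x = y)
    (measurableSet_eq_fun ((E.measurable_enum n).comp measurable_fst) measurable_snd)
  -- Clause 0 says that any two types are codes of related points, clause 1 that distinct elements
  -- have distinct codes, and clause `n + 2` that the `n`-th point in the class of each coded point
  -- is coded too. These express a homomorphism that is injective and surjective on classes.
  let ψ : InfFormula unaryLanguage 0 := .conj fun m => match m with
    | 0 => .all (.all ρ)
    | 1 => .all (.all (ε.imp (.equal 0 1)))
    | n + 2 => .all (((η n).imp .falsum).all.imp .falsum)
  have hψ : ∀ (M : Type) (A : unaryLanguage.Structure M), ψ.Realize A Fin.elim0 ↔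
      (∀ a b, ∃ x y, E.rel x y ∧ E.code x = unaryType A a ∧ E.code y = unaryType A b) ∧
      (∀ a b, (∃ x y, x = y ∧ E.code x = unaryType A a ∧ E.code y = unaryType A b) → a = b) ∧
      ∀ n a, ∃ b, ∃ x y, E.enum n x = y ∧ E.code x = unaryType A a ∧
        E.code y = unaryType A b := by
    intro M A
    simp only [← hρ, ← hε, ← hη]
    constructor
    · refine fun h => ⟨h 0, h 1, fun n a => ?_⟩
      by_contra hcon
      exact h (n + 2) a fun b hb => hcon ⟨b, hb⟩
    · rintro ⟨h0, h1, h2⟩ (_ | _ | n)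
      · exact h0
      · exact h1
      · intro a hcon
        obtain ⟨b, hb⟩ := h2 n a
        exact hcon b hb
  refine ⟨⟨unaryLanguage, isRelational_unaryLanguage, ?_, ⟨fun R => zero_ne_one R.2⟩, ψ⟩,
    fun F => ⟨?_, ?_⟩⟩
  · have : ∀ n, Countable (unaryLanguage.Relations n) := fun n =>
      inferInstanceAs (Countable {_k : ℕ // n = 1})
    infer_instance
  · rintro ⟨A, hm, -, hr⟩
    let t : F.carrier → ℕ → Bool := unaryType A
    have ht : Measurable t := measurable_pi_lambda _ fun k => measurable_to_bool <| by
      have := measurable_pi_lambda (fun (x : F.carrier) (_ : Fin 1) => x) (fun _ => measurable_id)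
        (hm 1 (unaryPred k))
      convert this using 1
      ext x
      exact @decide_eq_true_iff _ (Classical.propDecidable _)
    have hr' := fun x => (hψ _ _).1 (hr x)
    -- Clause 0 with both variables at the same element makes its type a genuine code.
    have hex : ∀ x, ∃ y, E.code y = t x := by
      intro x
      obtain ⟨y, -, -, hy, -⟩ := (hr' x).1 ⟨x, F.rel_refl x⟩ ⟨x, F.rel_refl x⟩
      exact ⟨y, hy⟩
    choose f hf using hex
    refine ⟨f, .of_forall ?_ ?_ ?_ ?_⟩
    · rw [← E.measurableEmbedding_code.measurable_comp_iff]
      rwa [show E.code ∘ f = t from funext hf]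
    · intro x y hxy
      obtain ⟨x', y', h, hx, hy⟩ := (hr' x).1 ⟨x, F.rel_refl x⟩ ⟨y, hxy⟩
      rw [E.code_injective ((hf x).trans hx.symm), E.code_injective ((hf y).trans hy.symm)]
      exact h
    · intro x y hxy he
      exact congrArg Subtype.val ((hr' x).2.1 ⟨x, F.rel_refl x⟩ ⟨y, hxy⟩
        ⟨f x, f y, he, hf x, hf y⟩)
    · intro x y hxy
      obtain ⟨n, rfl⟩ := E.rel_iff_enum.1 hxy
      obtain ⟨⟨b, hb⟩, x', y', rfl, hx, hy⟩ := (hr' x).2.2 n ⟨x, F.rel_refl x⟩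
      refine ⟨b, hb, ?_⟩
      rw [E.code_injective ((hf x).trans hx.symm)]
      exact E.code_injective ((hf b).trans hy.symm)
  · rintro ⟨f, hf⟩
    -- Every symbol has arity one, so the existential over `i` just selects the sole argument
    -- without a cast.
    let A : unaryLanguage.Structure F.carrier :=
      { funMap := fun g => ((isRelational_unaryLanguage _).false g).elim
        RelMap := fun R v => ∃ i, E.code (f (v i)) R.1 = true }
    have ht : ∀ (C : Set F.carrier) (a : C),
        unaryType (restrictStructure isRelational_unaryLanguage A C) a = E.code (f a) := by
      intro C a
      ext k
      rw [Bool.eq_iff_iff, unaryType, @decide_eq_true_iff _ (Classical.propDecidable _)]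
      exact ⟨fun ⟨_, h⟩ => h, fun h => ⟨0, h⟩⟩
    refine ⟨A, ?_, ?_, fun x => (hψ _ _).2 ⟨?_, ?_, ?_⟩⟩
    · intro n R
      refine Measurable.setOf (Measurable.exists fun i => ?_)
      exact measurableSet_setOfPred.1 ((measurable_pi_apply R.1).comp
        (E.measurableEmbedding_code.measurable.comp (hf.measurable.comp (measurable_pi_apply i)))
        (measurableSet_singleton true))
    · rintro n ⟨k, rfl⟩ v - i j
      rw [Subsingleton.elim i j]
      exact F.rel_refl _
    · rintro ⟨a, ha⟩ ⟨b, hb⟩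
      exact ⟨f a, f b, hf.map_rel _ _ (F.rel_trans (F.rel_symm ha) hb), (ht _ ⟨a, ha⟩).symm,
        (ht _ ⟨b, hb⟩).symm⟩
    · rintro ⟨a, ha⟩ ⟨b, hb⟩ ⟨y, _, rfl, h1, h2⟩
      rw [ht] at h1 h2
      exact Subtype.ext (hf.eq_of_rel (F.rel_trans (F.rel_symm ha) hb)
        (E.code_injective (h1.symm.trans h2)))
    · rintro n ⟨a, ha⟩
      obtain ⟨b, hb, he⟩ := hf.exists_rel (E.rel_enum n (f a))
      exact ⟨⟨b, F.rel_trans ha hb⟩, f a, f b, he.symm, (ht _ ⟨a, ha⟩).symm,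
        (ht _ ⟨b, F.rel_trans ha hb⟩).symm⟩

/-- Absorption is precisely universality in the class from `exists_theory`, to which `E` belongs
through the identity. -/
theorem universallyStructurable_iff_absorbing {E : CBER} :
    E.UniversallyStructurable ↔ E.Absorbing := by
  refine ⟨UniversallyStructurable.absorbing, fun h => ?_⟩
  obtain ⟨σ, hσ⟩ := E.exists_theory
  exact ⟨σ, (hσ E).2 ⟨id, .id E⟩, fun F hF => h F ((hσ F).1 hF)⟩

end CBER

namespace CBER

/-! ### The invariantly universal equivalence relation -/

theorem measurable_range_eq {α W : Type*} [MeasurableSpace α] [MeasurableSpace W] [MeasurableEq W]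
    {a b : α → ℕ → W} (ha : ∀ n, Measurable fun x => a x n) (hb : ∀ n, Measurable fun x => b x n) :
    Measurable fun x => range (a x) = range (b x) := by
  simp only [subset_antisymm_iff, range_subset_iff, mem_range]
  exact (Measurable.forall fun n => Measurable.exists fun m =>
    measurableSet_setOfPred.1 (measurableSet_eq_fun (hb m) (ha n))).and
    (Measurable.forall fun n => Measurable.exists fun m =>
    measurableSet_setOfPred.1 (measurableSet_eq_fun (ha m) (hb n)))

/-- The shift action of the free monoid on countably many generators. -/
def shift (z : List ℕ → ℕ → Bool) (n : ℕ) : List ℕ → ℕ → Bool := fun w => z (n :: w)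

theorem measurable_shift (n : ℕ) : Measurable fun z => shift z n :=
  measurable_pi_lambda _ fun w => measurable_pi_apply (n :: w)

/-- The points whose successors under the generators form a set that is the set of successors of
each of its members. -/
def universalSet : Set (List ℕ → ℕ → Bool) :=
  {z | z ∈ range (shift z) ∧ ∀ n, range (shift (shift z n)) = range (shift z)}

theorem measurableSet_universalSet : MeasurableSet universalSet := by
  refine Measurable.setOf ((Measurable.exists fun n => measurableSet_setOfPred.1
    (measurableSet_eq_fun (measurable_shift n) measurable_id)).and (Measurable.forall fun n =>
      measurable_range_eq (fun m => ?_) measurable_shift))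
  exact (measurable_shift m).comp (measurable_shift n)

/-- An invariantly universal countable Borel equivalence relation: having the same successors under
the shift. -/
def universal : CBER where
  carrier := universalSet
  standardBorel := measurableSet_universalSet.standardBorel
  rel z z' := range (shift z.1) = range (shift z'.1)
  equivalence := ⟨fun _ => rfl, Eq.symm, Eq.trans⟩
  measurable_rel := (measurable_range_eq
    (fun n => (measurable_shift n).comp (measurable_subtype_coe.comp measurable_fst))
    (fun n => (measurable_shift n).comp (measurable_subtype_coe.comp measurable_snd))).setOf
  countable_class z := by
    refine ((countable_range (shift z.1)).preimage Subtype.val_injective).mono ?_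
    rintro z' (h : range (shift z.1) = range (shift z'.1))
    exact h ▸ z'.2.1

/-- The action of the free monoid on countably many generators by an enumeration of the classes. -/
noncomputable def enumWord (E : CBER) : List ℕ → E.carrier → E.carrier
  | [], x => x
  | n :: w, x => enumWord E w (E.enum n x)

theorem measurable_enumWord (E : CBER) : ∀ w, Measurable (E.enumWord w)
  | [] => measurable_id
  | n :: w => (measurable_enumWord E w).comp (E.measurable_enum n)

/-- The equivariant map into the shift. -/
noncomputable def toShift (E : CBER) (x : E.carrier) : List ℕ → ℕ → Bool :=
  fun w => E.code (E.enumWord w x)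

theorem shift_toShift (E : CBER) (x : E.carrier) (n : ℕ) :
    shift (E.toShift x) n = E.toShift (E.enum n x) := rfl

theorem measurable_toShift (E : CBER) : Measurable E.toShift :=
  measurable_pi_lambda _ fun w => E.measurableEmbedding_code.measurable.comp
    (E.measurable_enumWord w)

theorem toShift_injective (E : CBER) : Function.Injective E.toShift := fun _ _ h =>
  E.code_injective (congrFun h [])

theorem range_shift_toShift (E : CBER) (x : E.carrier) :
    range (shift (E.toShift x)) = E.toShift '' E.cls x := by
  ext z
  constructor
  · rintro ⟨n, rfl⟩
    exact ⟨_, E.rel_enum n x, rfl⟩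
  · rintro ⟨y, hy, rfl⟩
    obtain ⟨n, rfl⟩ := E.rel_iff_enum.1 hy
    exact ⟨n, rfl⟩

theorem cls_eq_iff (E : CBER) {x y : E.carrier} : E.cls x = E.cls y ↔ E.rel x y := by
  constructor
  · intro h
    have hy : y ∈ E.cls y := E.rel_refl y
    rwa [← h] at hy
  · intro h
    ext z
    exact ⟨E.rel_trans (E.rel_symm h), E.rel_trans h⟩

theorem toShift_mem (E : CBER) (x : E.carrier) : E.toShift x ∈ universalSet := by
  refine ⟨?_, fun n => ?_⟩
  · rw [range_shift_toShift]
    exact ⟨x, E.rel_refl x, rfl⟩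
  · rw [shift_toShift, range_shift_toShift, range_shift_toShift,
      E.cls_eq_iff.2 (E.rel_enum n x)]

/-- Coding along all words lets the shift recover the coded point of every member of a class, so
successors of `toShift x` are the images of the class of `x`. A point with the same successors is
among its own successors, hence in the image; this gives invariance. -/
theorem invariantlyUniversal_universal : universal.InvariantlyUniversal := by
  refine fun E => ⟨fun x => ⟨E.toShift x, E.toShift_mem x⟩, E.measurable_toShift.subtype_mk,
    fun x y h => E.toShift_injective (congrArg Subtype.val h), fun x y => ?_, ?_⟩
  · change range _ = range _ ↔ _
    rw [range_shift_toShift, range_shift_toShift, E.toShift_injective.image_injective.eq_iff,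
      cls_eq_iff]
  · rintro x ⟨z, hz⟩ (h : range _ = range (shift z))
    rw [range_shift_toShift] at h
    obtain ⟨y, -, hy⟩ := h ▸ hz.1
    exact ⟨y, Subtype.ext hy⟩

theorem InvariantlyUniversal.absorbing {E : CBER} (h : E.InvariantlyUniversal) : E.Absorbing :=
  fun F _ => h F

theorem isInvariantEmbedding_of_isEmpty {F : CBER} (h : IsEmpty F.carrier) (E : CBER)
    (f : F.carrier → E.carrier) : IsInvariantEmbedding F E f :=
  ⟨measurable_of_empty f, fun x => h.elim x, fun x => h.elim x, fun x => h.elim x⟩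

theorem InvEmbeds.of_isEmpty {F : CBER} (h : IsEmpty F.carrier) (E : CBER) : InvEmbeds F E :=
  ⟨fun x => h.elim x, isInvariantEmbedding_of_isEmpty h E _⟩

theorem absorbing_empty : empty.Absorbing := by
  rintro F ⟨f, -⟩
  exact InvEmbeds.of_isEmpty ⟨fun x => (f x).elim⟩ _

/-! ### Tensor products -/

section Tensor

variable {ι : Type}

/-- A sequence in the product of the underlying spaces enumerates a set that projects bijectively
onto a class in each coordinate, and the enumeration is the one of the class of its first element in
the coordinate `i₀`. -/
structure IsTensorPoint (E : ι → CBER) (i₀ : ι) (y : ℕ → ∀ i, (E i).carrier) : Prop where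
  eq_enum : ∀ n, y n i₀ = (E i₀).enum n (y 0 i₀)
  injective : ∀ i n m, y n i = y m i → y n = y m
  rel : ∀ i n, (E i).rel (y 0 i) (y n i)
  surjective : ∀ i n, ∃ m, y m i = (E i).enum n (y 0 i)

variable {E : ι → CBER} {i₀ : ι}

theorem measurable_coord (n : ℕ) (i : ι) :
    Measurable fun y : ℕ → ∀ i, (E i).carrier => y n i :=
  (measurable_pi_apply i).comp (measurable_pi_apply n)

theorem measurableSet_isTensorPoint [Countable ι] (E : ι → CBER) (i₀ : ι) :
    MeasurableSet {y | IsTensorPoint E i₀ y} := by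
  have : {y | IsTensorPoint E i₀ y} = {y : ℕ → ∀ i, (E i).carrier |
      (∀ n, y n i₀ = (E i₀).enum n (y 0 i₀)) ∧ (∀ i n m, y n i = y m i → y n = y m) ∧
      (∀ i n, (E i).rel (y 0 i) (y n i)) ∧ ∀ i n, ∃ m, y m i = (E i).enum n (y 0 i)} := by
    ext y
    exact ⟨fun h => ⟨h.1, h.2, h.3, h.4⟩, fun h => ⟨h.1, h.2.1, h.2.2.1, h.2.2.2⟩⟩
  rw [this]
  have heq : ∀ {β : Type} [MeasurableSpace β] [MeasurableEq β]
      {f g : (ℕ → ∀ i, (E i).carrier) → β}, Measurable f → Measurable g →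
      Measurable fun y => f y = g y := fun hf hg =>
    measurableSet_setOfPred.1 (measurableSet_eq_fun hf hg)
  exact ((Measurable.forall fun n => heq (measurable_coord n i₀)
      (((E i₀).measurable_enum n).comp (measurable_coord 0 i₀))).and
    ((Measurable.forall fun i => Measurable.forall fun n => Measurable.forall fun m =>
      (heq (measurable_coord n i) (measurable_coord m i)).imp
        (heq (measurable_pi_apply n) (measurable_pi_apply m))).and
    ((Measurable.forall fun i => Measurable.forall fun n =>
      (E i).measurable_rel_comp (measurable_coord 0 i) (measurable_coord n i)).and
    (Measurable.forall fun i => Measurable.forall fun n => Measurable.exists fun m =>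
      heq (measurable_coord m i) (((E i).measurable_enum n).comp (measurable_coord 0 i)))))).setOf

theorem IsTensorPoint.exists_coord {y : ℕ → ∀ i, (E i).carrier} (hy : IsTensorPoint E i₀ y) {i : ι}
    {n : ℕ} {x : (E i).carrier} (h : (E i).rel (y n i) x) : ∃ m, y m i = x := by
  obtain ⟨k, rfl⟩ := (E i).rel_iff_enum.1 ((E i).rel_trans (hy.rel i n) h)
  exact hy.surjective i k

/-- Within the enumerated set one coordinate determines the tuple, and coordinate `i₀` of the
enumeration is dictated by the first term. -/
theorem IsTensorPoint.eq_of_range_eq {y y' : ℕ → ∀ i, (E i).carrier} (hy : IsTensorPoint E i₀ y)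
    (hy' : IsTensorPoint E i₀ y') (h : range y = range y') {i : ι} (h0 : y 0 i = y' 0 i) :
    y = y' := by
  have key : ∀ {n m j}, y n j = y' m j → y n = y' m := by
    intro n m j hj
    obtain ⟨k, hk⟩ : y' m ∈ range y := h ▸ mem_range_self m
    rw [← hk] at hj ⊢
    exact hy.injective _ _ _ hj
  funext n
  refine key (j := i₀) ?_
  rw [hy.eq_enum, hy'.eq_enum, key h0]

/-- The enumeration of the set enumerated by a tensor point based at another element. -/
theorem IsTensorPoint.exists_rebase {y : ℕ → ∀ i, (E i).carrier} (hy : IsTensorPoint E i₀ y)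
    (m : ℕ) : ∃ y', IsTensorPoint E i₀ y' ∧ range y' = range y ∧ y' 0 = y m := by
  choose k hk using fun n => hy.exists_coord ((E i₀).rel_enum n (y m i₀))
  have h0 : y (k 0) = y m := hy.injective i₀ _ _ (by rw [hk, enum_zero])
  have hsurj : ∀ n, ∃ l, y (k l) = y n := by
    intro n
    obtain ⟨l, hl⟩ := (E i₀).rel_iff_enum.1
      ((E i₀).rel_trans ((E i₀).rel_symm (hy.rel i₀ m)) (hy.rel i₀ n))
    exact ⟨l, hy.injective i₀ _ _ (by rw [hk, hl])⟩
  refine ⟨fun n => y (k n), ⟨fun n => ?_, fun i n n' => hy.injective i _ _, fun i n => ?_,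
    fun i n => ?_⟩, ?_, h0⟩
  · rw [h0, hk]
  · exact (E i).rel_trans ((E i).rel_symm (hy.rel i _)) (hy.rel i _)
  · obtain ⟨l, hl⟩ := hy.exists_coord ((E i).rel_enum n (y (k 0) i))
    obtain ⟨l', hl'⟩ := hsurj l
    exact ⟨l', by rw [hl', hl]⟩
  · refine subset_antisymm (range_subset_iff.2 fun n => ⟨_, rfl⟩) (range_subset_iff.2 hsurj)

/-- The class-bijective product of a countable family. -/
def tensor [Countable ι] (E : ι → CBER) (i₀ : ι) : CBER where
  carrier := {y | IsTensorPoint E i₀ y}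
  standardBorel := (measurableSet_isTensorPoint E i₀).standardBorel
  rel y y' := range y.1 = range y'.1
  equivalence := ⟨fun _ => rfl, Eq.symm, Eq.trans⟩
  measurable_rel := (measurable_range_eq
    (fun n => (measurable_pi_apply n).comp (measurable_subtype_coe.comp measurable_fst))
    (fun n => (measurable_pi_apply n).comp (measurable_subtype_coe.comp measurable_snd))).setOf
  countable_class y := by
    -- A member of the class is determined by its first term, which lies in a fixed countable range.
    refine MapsTo.countable_of_injOn (f := fun y' => y'.1 0) (t := range y.1) ?_ ?_
      (countable_range _)
    · rintro y' (h : range y.1 = range y'.1)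
      exact h ▸ mem_range_self 0
    · rintro y' (h : range y.1 = range y'.1) y'' (h' : range y.1 = range y''.1) h0
      exact Subtype.ext (y'.2.eq_of_range_eq y''.2 (h.symm.trans h') (congrFun h0 i₀))

/-- The projections of the class-bijective product. -/
def tensorProj [Countable ι] (E : ι → CBER) (i₀ i : ι) (y : (tensor E i₀).carrier) :
    (E i).carrier := y.1 0 i

theorem isClassBijective_tensorProj [Countable ι] (E : ι → CBER) (i₀ i : ι) :
    IsClassBijective (tensor E i₀) (E i) (tensorProj E i₀ i) := by
  refine .of_forall ((measurable_coord 0 i).comp measurable_subtype_coe) ?_ ?_ ?_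
  · rintro y y' (h : range y.1 = range y'.1)
    obtain ⟨n, hn⟩ : y'.1 0 ∈ range y.1 := h ▸ mem_range_self 0
    change (E i).rel (y.1 0 i) (y'.1 0 i)
    rw [← hn]
    exact y.2.rel i n
  · exact fun y y' h h0 => Subtype.ext (y.2.eq_of_range_eq y'.2 h h0)
  · intro y x h
    obtain ⟨m, rfl⟩ := y.2.exists_coord h
    obtain ⟨y', hy', hr, h0⟩ := y.2.exists_rebase m
    exact ⟨⟨y', hy'⟩, hr.symm, congrFun h0 i⟩

/-- The lift sends `x` to the set of tuples `(f i x')` for `x'` in the class of `x`, enumerated from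
`x` in the order pulled back from coordinate `i₀`. -/
theorem isTensorProduct_tensor [Countable ι] (E : ι → CBER) (i₀ : ι) :
    IsTensorProduct E (tensor E i₀) (tensorProj E i₀) := by
  refine ⟨isClassBijective_tensorProj E i₀, fun G f hf => ?_⟩
  choose k hk hke using fun n x => (hf i₀).exists_rel ((E i₀).rel_enum n (f i₀ x))
  -- Since `f i₀` is injective on classes, equality of `k n x` with an enumerated point can be
  -- tested after applying `f i₀`.
  have hkm : ∀ n, Measurable (k n) := fun n =>
    G.measurable_of_measurable_eq_enum (hk n) fun m => by
      have : ∀ x, k n x = G.enum m x ↔ (E i₀).enum n (f i₀ x) = f i₀ (G.enum m x) := by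
        intro x
        rw [← hke n x]
        exact ⟨congrArg _, (hf i₀).eq_of_rel (G.rel_trans (G.rel_symm (hk n x)) (G.rel_enum m x))⟩
      simp only [this]
      exact measurableSet_setOfPred.1 (measurableSet_eq_fun
        (((E i₀).measurable_enum n).comp (hf i₀).measurable)
        ((hf i₀).measurable.comp (G.measurable_enum m)))
  have hk0 : ∀ x, k 0 x = x := fun x =>
    ((hf i₀).eq_of_rel (hk 0 x) (by rw [hke, enum_zero])).symm
  have hksurj : ∀ x x', G.rel x x' → ∃ n, k n x = x' := by
    intro x x' h
    obtain ⟨n, hn⟩ := (E i₀).rel_iff_enum.1 ((hf i₀).map_rel _ _ h)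
    exact ⟨n, (hf i₀).eq_of_rel (G.rel_trans (G.rel_symm (hk n x)) h) ((hke n x).trans hn)⟩
  let h' : G.carrier → ℕ → ∀ i, (E i).carrier := fun x n i => f i (k n x)
  have hpt : ∀ x, IsTensorPoint E i₀ (h' x) := by
    intro x
    refine ⟨fun n => ?_, fun i n m h => ?_, fun i n => ?_, fun i n => ?_⟩
    · simp only [h', hke, enum_zero]
    · have : k n x = k m x := (hf i).eq_of_rel (G.rel_trans (G.rel_symm (hk n x)) (hk m x)) h
      funext j
      simp only [h', this]
    · simp only [h', hk0]
      exact (hf i).map_rel _ _ (hk n x)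
    · simp only [h', hk0]
      obtain ⟨x', hx', he⟩ := (hf i).exists_rel ((E i).rel_enum n (f i x))
      obtain ⟨m, rfl⟩ := hksurj x x' hx'
      exact ⟨m, he⟩
  have hrange : ∀ x, range (h' x) = (fun x' i => f i x') '' G.cls x := by
    intro x
    ext w
    constructor
    · rintro ⟨n, rfl⟩
      exact ⟨k n x, hk n x, rfl⟩
    · rintro ⟨x', hx', rfl⟩
      obtain ⟨n, rfl⟩ := hksurj x x' hx'
      exact ⟨n, rfl⟩
  let h : G.carrier → (tensor E i₀).carrier := fun x => ⟨h' x, hpt x⟩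
  have hcomp : ∀ i x, tensorProj E i₀ i (h x) = f i x := fun i x => congrArg (f i) (hk0 x)
  have hrel : ∀ x x', G.rel x x' → (tensor E i₀).rel (h x) (h x') := by
    intro x x' hx
    change range (h' x) = range (h' x')
    rw [hrange, hrange, G.cls_eq_iff.2 hx]
  refine ⟨h, ⟨.of_forall ?_ hrel ?_ ?_, fun i => funext (hcomp i)⟩, ?_⟩
  · exact Measurable.subtype_mk (measurable_pi_lambda _ fun n => measurable_pi_lambda _ fun i =>
      (hf i).measurable.comp (hkm n))
  · intro x x' hx he
    exact (hf i₀).eq_of_rel hx (by rw [← hcomp, ← hcomp, he])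
  · intro x y hy
    obtain ⟨n, hn⟩ : y.1 0 ∈ range (h' x) := (show range (h' x) = range y.1 from hy) ▸
      mem_range_self 0
    refine ⟨k n x, hk n x, (isClassBijective_tensorProj E i₀ i₀).eq_of_rel
      ((tensor E i₀).rel_trans (hrel _ _ (G.rel_symm (hk n x))) hy) ?_⟩
    rw [hcomp]
    exact congrFun hn i₀
  -- By `eq_of_range_eq` it suffices to match the ranges. Rebasing `g x` at any of its terms gives a
  -- point of the same class, hence some `g x'` with `x'` related to `x`, so that term is the tuple
  -- of `f i x'`.
  · rintro g ⟨hg, hgf⟩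
    have hgf' : ∀ i x, (g x).1 0 i = f i x := fun i x => congrFun (hgf i) x
    funext x
    refine Subtype.ext (IsTensorPoint.eq_of_range_eq (i := i₀) (g x).2 (h x).2 ?_
      ((hgf' i₀ x).trans (hcomp i₀ x).symm))
    change _ = range (h' x)
    rw [hrange]
    ext w
    constructor
    · rintro ⟨n, rfl⟩
      obtain ⟨y', hy', hr, h0⟩ := (g x).2.exists_rebase n
      obtain ⟨x', hx', he⟩ := hg.exists_rel (y := ⟨y', hy'⟩) hr.symm
      refine ⟨x', hx', ?_⟩
      funext i
      change f i x' = _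
      rw [← hgf', he]
      exact congrFun h0 i
    · rintro ⟨x', hx', rfl⟩
      rw [show range (g x).1 = range (g x').1 from hg.map_rel _ _ hx']
      exact ⟨0, funext fun i => hgf' i x'⟩

/-- The lift of the embeddings is injective because its composite with one projection is; this needs
at least one index. -/
theorem IsTensorProduct.invEmbeds_of_forall [Nonempty ι] {P : CBER}
    {π : ∀ i, P.carrier → (E i).carrier} (hP : IsTensorProduct E P π) {G : CBER}
    (h : ∀ i, InvEmbeds G (E i)) : InvEmbeds G P := by
  choose f hf using h
  obtain ⟨h, ⟨hh, hπ⟩, -⟩ := hP.existsUnique_lift G f fun i => (hf i).isClassBijective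
  obtain ⟨i⟩ := ‹Nonempty ι›
  refine ⟨h, hh.isInvariantEmbedding (Function.Injective.of_comp (f := π i) ?_)⟩
  rw [hπ]
  exact (hf i).injective

theorem IsTensorProduct.invEmbeds {P : CBER} {π : ∀ i, P.carrier → (E i).carrier}
    (hP : IsTensorProduct E P π) (hE : ∀ i, (E i).Absorbing) (i : ι) : InvEmbeds P (E i) :=
  hE i P ⟨π i, hP.proj i⟩

theorem IsTensorProduct.absorbing [Nonempty ι] {P : CBER} {π : ∀ i, P.carrier → (E i).carrier}
    (hP : IsTensorProduct E P π) (hE : ∀ i, (E i).Absorbing) : P.Absorbing := by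
  rintro F ⟨f, hf⟩
  exact hP.invEmbeds_of_forall fun i => hE i F ⟨_, (hP.proj i).comp hf⟩

end Tensor

end CBER

namespace CBER

/-! ### Joins -/

section Join

variable {ι : Type} [Countable ι]

/-- The map factors through a sum of copies of `K`, one for each piece, followed by folding the
copies together. -/
theorem isClassBijective_piecewise {F K : CBER} {c : F.carrier → ι}
    (hc : ∀ i, MeasurableSet {x | c x = i}) (hinv : ∀ x y, F.rel x y → c x = c y)
    {h : ι → F.carrier → K.carrier} (hh : ∀ i, IsClassBijective F K (h i)) :
    IsClassBijective F K fun x => h (c x) x :=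
  (isClassBijective_sumDesc (E := fun _ : ι => K) fun _ => .id K).comp
    (isClassBijective_glue (hc := hc) hinv fun i => (hh i).comp
      (F.isInvariantEmbedding_val _ (hc i) fun x y hxy (hx : c x = i) =>
        (hinv x y hxy).symm.trans hx).isClassBijective)

/-- If the `E i` are absorbing and invariantly embed into `G`, so does their sum. The embeddings
into `G` are corrected by moving a class whose image already lies in the image of a summand of
smaller index to a fresh copy inside that summand, recording where it came from. -/
theorem InvEmbeds.sum_of_absorbing {E : ι → CBER} {G : CBER} (hE : ∀ i, (E i).Absorbing)
    (h : ∀ i, InvEmbeds (E i) G) : InvEmbeds (sum E) G := by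
  classical
  choose f hf using h
  obtain ⟨e, he⟩ := Countable.exists_injective_nat ι
  let S : CBER := sum E
  let idx : S.carrier → ι := sumFst
  have hidx : ∀ s s', S.rel s s' → idx s = idx s' := fun s s' => sum_rel_fst
  have hidxm : ∀ i, MeasurableSet {s | idx s = i} := fun i => measurableSet_fst_eq i
  let q : S.carrier → G.carrier := fun s => f (sumFst s) s.2
  have hq : IsClassBijective S G q := isClassBijective_sumDesc fun i => (hf i).isClassBijective
  have hqmk : ∀ i x, q (sumMk E i x) = f i x := fun _ _ => rfl
  have hqidx : ∀ s s', idx s = idx s' → q s = q s' → s = s' := by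
    rintro ⟨i, x⟩ ⟨i', x'⟩ h1 h2
    obtain rfl : i = i' := h1
    exact congrArg (sumMk E i) ((hf i).injective h2)
  -- the retraction onto points of minimal index
  have hρ : ∀ s, ∃ r, q r = q s ∧ ∀ r', q r' = q s → e (idx r) ≤ e (idx r') := by
    intro s
    obtain ⟨r, hr, hmin⟩ := (measure fun r => e (idx r)).wf.has_min {r | q r = q s} ⟨s, rfl⟩
    exact ⟨r, hr, fun r' hr' => not_lt.1 (hmin r' hr')⟩
  choose ρ hρq hρmin using hρ
  have hρeq : ∀ s s', q s = q s' → ρ s = ρ s' := fun s s' h =>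
    hqidx _ _ (he (le_antisymm (hρmin s _ ((hρq s').trans h.symm))
      (hρmin s' _ ((hρq s).trans h)))) ((hρq s).trans (h.trans (hρq s').symm))
  -- The least index hitting a point of `G` depends only on its class, because the images of the
  -- summands are invariant.
  have hρidx : ∀ s s', S.rel s s' → e (idx (ρ s)) ≤ e (idx (ρ s')) := by
    intro s s' h
    have h1 : G.rel (q (ρ s')) (q s) := by
      rw [hρq]
      exact hq.map_rel _ _ (S.rel_symm h)
    obtain ⟨r, hr, hrq⟩ := hq.exists_rel h1
    rw [hidx _ _ hr]
    exact hρmin s r hrq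
  have hρrel : ∀ s s', S.rel s s' → S.rel (ρ s) (ρ s') := by
    intro s s' h
    have h1 : idx (ρ s) = idx (ρ s') := he (le_antisymm (hρidx s s' h) (hρidx s' s (S.rel_symm h)))
    have h2 : G.rel (q (ρ s)) (q (ρ s')) := by
      rw [hρq, hρq]
      exact hq.map_rel _ _ h
    obtain ⟨r, hr, hrq⟩ := hq.exists_rel h2
    rwa [← hqidx r (ρ s') ((hidx _ _ hr).symm.trans h1) hrq]
  have hρcb : IsClassBijective S S ρ := by
    refine .of_forall (fun U hU => ?_) hρrel ?_ ?_
    · have : ρ ⁻¹' U = ⋃ i, q ⁻¹' (f i '' (sumMk E i ⁻¹' U)) ∩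
          {s | ∀ j, e j < e i → q s ∉ range (f j)} := by
        ext s
        simp only [mem_iUnion, mem_inter_iff, mem_preimage]
        constructor
        · intro hs
          obtain ⟨x, hx⟩ := exists_sumMk (ρ s)
          refine ⟨idx (ρ s), ⟨x, ?_, ?_⟩, ?_⟩
          · rwa [mem_preimage, hx]
          · exact ((hqmk _ x).symm.trans (congrArg q hx)).trans (hρq s)
          · rintro j hj ⟨y, hy⟩
            exact (hρmin s (sumMk E j y) hy).not_gt hj
        · rintro ⟨i, ⟨x, hx, hxs⟩, hmin⟩
          have : ρ s = sumMk E i x := by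
            refine hqidx _ _ (he (le_antisymm (hρmin s _ hxs) ?_)) ((hρq s).trans hxs.symm)
            by_contra! hlt
            exact hmin _ hlt ⟨(ρ s).2, hρq s⟩
          rwa [this]
      rw [this]
      refine MeasurableSet.iUnion fun i => MeasurableSet.inter (hq.measurable
        (((hf i).measurable.measurableEmbedding (hf i).injective).measurableSet_image'
          (measurable_sumMk i hU))) (Measurable.setOf (Measurable.forall fun j =>
            measurable_const.imp ?_))
      exact (((hf j).measurable.measurableEmbedding
        (hf j).injective).measurableSet_range.mem.comp hq.measurable).not
    · intro s s' h h'
      exact hq.eq_of_rel h (by rw [← hρq s, ← hρq s', h'])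
    · intro s y h
      have h1 : G.rel (q s) (q y) := by
        rw [← hρq s]
        exact hq.map_rel _ _ h
      obtain ⟨s', hs', hsq⟩ := hq.exists_rel h1
      exact ⟨s', hs', hq.eq_of_rel (S.rel_trans (hρrel _ _ (S.rel_symm hs')) h)
        ((hρq s').trans hsq)⟩
  -- countably many disjoint copies of each summand inside itself
  have hθ : ∀ i, InvEmbeds (sum fun _ : Option ι => E i) (E i) := fun i =>
    hE i _ ⟨_, isClassBijective_sumDesc fun _ => .id (E i)⟩
  choose θ hθ using hθ
  let D : CBER := sum fun _ : Option ι => S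
  let fst : D.carrier → Option ι := sumFst
  let snd : D.carrier → S.carrier := fun d => d.2
  let mk : Option ι → S.carrier → D.carrier := sumMk fun _ => S
  have hsnd : IsClassBijective D S snd := isClassBijective_sumDesc fun _ => .id S
  have hext : ∀ d d', fst d = fst d' → snd d = snd d' → d = d' := by
    rintro ⟨c, s⟩ ⟨c', s'⟩ h1 h2
    change c = c' at h1
    change s = s' at h2
    rw [h1, h2]
  have hmkcb : ∀ c, IsClassBijective S D (mk c) := fun c =>
    (isInvariantEmbedding_mk (E := fun _ : Option ι => S) c).isClassBijective
  -- `Θ` places the copy labelled by `fst d` inside the summand of `snd d`; it is injective and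
  -- keeps the index.
  let Θ : D.carrier → S.carrier := fun d =>
    sumMk E (sumFst (snd d)) (θ (sumFst (snd d)) (sumMk _ (fst d) (snd d).2))
  have hΘ : IsClassBijective D S Θ :=
    isClassBijective_sumDesc (E := fun _ : Option ι => S) (K := S)
      (q := fun c s => Θ (mk c s)) fun c =>
      isClassBijective_sumDesc (E := E) (K := S)
        (q := fun i x => sumMk E i (θ i (sumMk (fun _ : Option ι => E i) c x))) fun i =>
        (isInvariantEmbedding_mk i).isClassBijective.comp
          ((hθ i).isClassBijective.comp
            (isInvariantEmbedding_mk (E := fun _ : Option ι => E i) c).isClassBijective)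
  have hΘidx : ∀ d, idx (Θ d) = idx (snd d) := fun _ => rfl
  have hΘinj : Function.Injective Θ := by
    rintro ⟨c, i, x⟩ ⟨c', i', x'⟩ h
    obtain rfl : i = i' := congrArg idx h
    have h1 := (hθ i).injective (sumMk_injective i h)
    obtain rfl : c = c' := congrArg sumFst h1
    obtain rfl : x = x' := sumMk_injective (E := fun _ : Option ι => E i) c h1
    rfl
  -- A colliding point moves to the minimal-index point with the same image in `G`. Its new label is
  -- the index it left, while `none` marks starting points.
  let R : D.carrier → D.carrier := fun d => mk (some (idx (snd d))) (ρ (Θ d))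
  have hR : IsClassBijective D D R :=
    isClassBijective_piecewise (c := fun d => idx (snd d))
      (h := fun i d => mk (some i) (ρ (Θ d)))
      (fun i => hsnd.measurable (hidxm i)) (fun d d' h => hidx _ _ (hsnd.map_rel _ _ h))
      fun i => (hmkcb (some i)).comp (hρcb.comp hΘ)
  let N : D.carrier → Prop := fun d => ρ (Θ d) = Θ d
  have hN : ∀ d d', D.rel d d' → N d → N d' := by
    intro d d' h (hd : ρ (Θ d) = Θ d)
    refine hq.eq_of_rel (S.rel_trans (hρrel _ _ (hΘ.map_rel _ _ (D.rel_symm h))) ?_) (hρq _)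
    rw [hd]
    exact hΘ.map_rel _ _ h
  have hNm : MeasurableSet {d | N d} :=
    measurableSet_eq_fun (hρcb.measurable.comp hΘ.measurable) hΘ.measurable
  let step : D.carrier → D.carrier := fun d => if N d then d else R d
  have hstep : IsClassBijective D D step := by
    have := isClassBijective_piecewise (F := D) (K := D) (c := fun d => decide (N d))
      (h := fun b d => if b then d else R d) (fun b => ?_) (fun d d' h => ?_) ?_
    · simpa only [decide_eq_true_eq] using this
    · cases b
      · simpa using (measurableSet_setOfPred.1 hNm).not
      · simpa using hNm
    · exact decide_eq_decide.2 ⟨hN d d' h, hN d' d (D.rel_symm h)⟩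
    · rintro (_ | _)
      · simpa using hR
      · exact IsClassBijective.id D
  have hiter : ∀ n, IsClassBijective D D step^[n] := by
    intro n
    induction n with
    | zero => exact .id D
    | succ n ih => exact ih.comp hstep
  have hstepN : ∀ d, N d → step d = d := fun d h => if_pos h
  have hstepR : ∀ d, ¬ N d → step d = R d := fun d h => if_neg h
  -- Each actual move strictly lowers the index, so `e` of the initial index bounds the number of
  -- moves.
  have hhalt : ∀ n d, e (idx (snd d)) ≤ n → N (step^[n] d) := by
    have hlt : ∀ d, ¬ N d → e (idx (snd (R d))) < e (idx (snd d)) := by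
      intro d hd
      refine lt_of_le_of_ne (hρmin (Θ d) (Θ d) rfl) fun heq => hd ?_
      exact hqidx _ _ (he heq) (hρq _)
    intro n
    induction n with
    | zero =>
      intro d hd
      by_contra hN
      exact absurd (hlt d hN) (by omega)
    | succ n ih =>
      intro d hd
      rw [Function.iterate_succ_apply]
      by_cases hN : N d
      · rw [hstepN d hN, Function.iterate_fixed (hstepN d hN)]
        exact hN
      · rw [hstepR d hN]
        exact ih _ (by have := hlt d hN; omega)
  let r : D.carrier → D.carrier → Prop := fun d' d => ¬ N d ∧ R d = d'
  have hreach : ∀ n d, Relation.ReflTransGen r (step^[n] d) d := by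
    intro n
    induction n with
    | zero => exact fun d => .refl
    | succ n ih =>
      intro d
      rw [Function.iterate_succ_apply]
      by_cases hN : N d
      · rw [hstepN d hN]
        exact ih d
      · rw [hstepR d hN]
        exact (ih _).tail ⟨hN, rfl⟩
  -- Moves can be undone: the label gives the old index, the new point gives the old image in `G`,
  -- and together these determine the old point.
  have hruniq : Relator.RightUnique r := by
    rintro d a b ⟨-, rfl⟩ ⟨-, hb⟩
    have h1 : idx (snd b) = idx (snd a) := Option.some_injective _ (congrArg fst hb)
    have h2 : ρ (Θ b) = ρ (Θ a) := congrArg snd hb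
    refine (hΘinj (hqidx _ _ h1 ?_)).symm
    rw [← hρq (Θ b), h2, hρq]
  have hnone : ∀ s s', Relation.ReflTransGen r (mk none s) (mk none s') → s = s' := by
    intro s s' h
    rcases h.cases_head with h | ⟨d, ⟨-, hd⟩, -⟩
    · exact congrArg snd h
    · exact absurd (congrArg fst hd) (Option.some_ne_none _)
  refine ⟨fun s => q (Θ (step^[e (idx s)] (mk none s))), IsClassBijective.isInvariantEmbedding
    (hq.comp (hΘ.comp (isClassBijective_piecewise (c := idx) (h := fun i s => step^[e i] (mk none s))
      hidxm hidx fun i => (hiter _).comp (hmkcb none)))) ?_⟩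
  -- Halted points with equal images coincide. Tracing moves back from the common end, one start is
  -- reachable from the other, and no move ends at a label `none`, so the starts are equal.
  intro s s' h
  have h1 : N (step^[e (idx s)] (mk none s)) := hhalt _ _ le_rfl
  have h2 : N (step^[e (idx s')] (mk none s')) := hhalt _ _ le_rfl
  have h3 := hΘinj (h1.symm.trans ((hρeq _ _ h).trans h2))
  have h4 := hreach (e (idx s)) (mk none s)
  have h5 := hreach (e (idx s')) (mk none s')
  rw [h3] at h4
  rcases h4.total_of_right_unique hruniq h5 with h | h
  · exact hnone _ _ h
  · exact (hnone _ _ h).symm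

/-- The pieces are the preimages of the summands. This works for every `F` and yields distributivity
of meets over joins. -/
theorem InvEmbeds.exists_pieces {E : ι → CBER} {F : CBER} (h : InvEmbeds F (sum E)) :
    ∃ F' : ι → CBER, (∀ i, InvEmbeds (F' i) F) ∧ (∀ i, InvEmbeds (F' i) (E i)) ∧
      InvEmbeds F (sum F') := by
  obtain ⟨f, hf⟩ := h
  have hm := measurableSet_fibre hf.isClassBijective
  refine ⟨fun i => F.restrict _ (hm i), fun i => ⟨_, F.isInvariantEmbedding_val _ (hm i) ?_⟩,
    fun i => ?_, ⟨_, isInvariantEmbedding_glue (hc := hm) (fst_eq_of_rel hf.isClassBijective)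
      fun i => (Iso.refl _).invEmbeds.choose_spec⟩⟩
  · exact fun x y h hx => (fst_eq_of_rel hf.isClassBijective x y h).symm.trans hx
  · obtain ⟨g, hg, hgf⟩ := exists_isClassBijective_fibre hf.isClassBijective i (hm i)
    refine ⟨g, hg.isInvariantEmbedding fun x y h => Subtype.ext (hf.injective ?_)⟩
    rw [← hgf, ← hgf, h]

theorem InvEmbeds.sum_congr {E F : ι → CBER} (h : ∀ i, InvEmbeds (E i) (F i)) :
    InvEmbeds (sum E) (sum F) := by
  choose f hf using h
  refine ⟨_, (isClassBijective_sumDesc (q := fun i x => sumMk F i (f i x)) fun i =>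
    (isInvariantEmbedding_mk i).isClassBijective.comp
      (hf i).isClassBijective).isInvariantEmbedding ?_⟩
  rintro ⟨i, x⟩ ⟨i', x'⟩ h
  obtain rfl : i = i' := congrArg sumFst h
  obtain rfl : x = x' := (hf i).injective (sumMk_injective i h)
  rfl

/-- Countably many invariant Borel sets partition the space by the first one containing a point. -/
theorem exists_first (F : CBER) {A : ι → Set F.carrier} (hA : ∀ i, MeasurableSet (A i))
    (hinv : ∀ i x y, F.rel x y → x ∈ A i → y ∈ A i) :
    ∃ c : F.carrier → Option ι, (∀ o, MeasurableSet {x | c x = o}) ∧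
      (∀ x y, F.rel x y → c x = c y) ∧ (∀ x i, c x = some i → x ∈ A i) ∧
      ∀ x, c x = none → ∀ i, x ∉ A i := by
  obtain ⟨e, he⟩ := Countable.exists_injective_nat ι
  have : ∀ x, ∃ o : Option ι, (∀ i, o = some i ↔ x ∈ A i ∧ ∀ j, e j < e i → x ∉ A j) ∧
      (o = none ↔ ∀ i, x ∉ A i) := by
    intro x
    by_cases h : ∃ i, x ∈ A i
    · obtain ⟨i, hi, hmin⟩ := (measure e).wf.has_min {i | x ∈ A i} h
      refine ⟨some i, fun k => ⟨?_, ?_⟩, ?_⟩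
      · rintro ⟨⟩
        exact ⟨hi, fun j hj hx => hmin j hx hj⟩
      · rintro ⟨hk, hk'⟩
        exact congrArg some (he (le_antisymm (not_lt.1 (hmin k hk))
          (not_lt.1 fun hlt => hk' i hlt hi)))
      · exact ⟨fun h => (Option.some_ne_none _ h).elim, fun h => (h i hi).elim⟩
    · push Not at h
      exact ⟨none, fun k => ⟨fun h => (Option.some_ne_none _ h.symm).elim,
        fun hk => (h k hk.1).elim⟩, fun _ => h, fun _ => rfl⟩
  choose c hc hc' using this
  have hiff : ∀ i x y, F.rel x y → (x ∈ A i ↔ y ∈ A i) := fun i x y h =>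
    ⟨hinv i x y h, hinv i y x (F.rel_symm h)⟩
  refine ⟨c, ?_, fun x y h => ?_, fun x i h => ((hc x i).1 h).1, fun x => (hc' x).1⟩
  · rintro (_ | i)
    · simp only [hc']
      exact (Measurable.forall fun i => (hA i).mem.not).setOf
    · simp only [hc]
      exact ((hA i).mem.and (Measurable.forall fun j =>
        measurable_const.imp (hA j).mem.not)).setOf
  · cases hy : c y with
    | none =>
      rw [hc']
      exact fun i => (hiff i x y h).not.2 ((hc' y).1 hy i)
    | some i =>
      rw [hc]
      obtain ⟨h1, h2⟩ := (hc y i).1 hy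
      exact ⟨(hiff i x y h).2 h1, fun j hj => (hiff j x y h).not.2 (h2 j hj)⟩

end Join

end CBER

namespace CBER

/-! ### The lattice of universally structurable equivalence relations -/

section Lattice

variable {ι : Type}

theorem isLUB_sum [Countable ι] {E : ι → CBER} (hE : ∀ i, (E i).Absorbing) :
    IsLUB (range fun i => (E i).toIsoClass) (sum E).toIsoClass := by
  constructor
  · rintro _ ⟨i, rfl⟩
    exact ⟨_, isInvariantEmbedding_mk i⟩
  · rintro ⟨G⟩ hG
    exact InvEmbeds.sum_of_absorbing hE fun i => hG ⟨i, rfl⟩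

theorem IsTensorProduct.isGLB [Nonempty ι] {E : ι → CBER} {P : CBER}
    {π : ∀ i, P.carrier → (E i).carrier} (hP : IsTensorProduct E P π)
    (hE : ∀ i, (E i).Absorbing) :
    IsGLB (range fun i => (E i).toIsoClass) P.toIsoClass := by
  constructor
  · rintro _ ⟨i, rfl⟩
    exact hP.invEmbeds hE i
  · rintro ⟨G⟩ hG
    exact hP.invEmbeds_of_forall fun i => hG ⟨i, rfl⟩

theorem InvariantlyUniversal.le_toIsoClass {E : CBER} (h : E.InvariantlyUniversal) (c : IsoClass) :
    c ≤ E.toIsoClass := by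
  induction c using Quotient.inductionOn with
  | h F => exact h F

theorem empty_le (c : IsoClass) : empty.toIsoClass ≤ c := by
  induction c using Quotient.inductionOn with
  | h F => exact InvEmbeds.of_isEmpty (F := empty) (inferInstanceAs (IsEmpty Empty)) F

theorem Absorbing.universallyStructurable {E : CBER} (h : E.Absorbing) :
    E.UniversallyStructurable :=
  universallyStructurable_iff_absorbing.2 h

theorem UnivStrClass.exists_rep (a : UnivStrClass) : ∃ E : CBER, E.Absorbing ∧
    E.toIsoClass = a.1 := by
  obtain ⟨E, hE, h⟩ := a.2
  exact ⟨E, hE.absorbing, h⟩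

theorem isLUB_subtype {P : Type*} [PartialOrder P] {p : P → Prop} {A : Set (Subtype p)}
    {a : Subtype p} (h : IsLUB (Subtype.val '' A) a.1) : IsLUB A a :=
  ⟨fun _ hb => h.1 ⟨_, hb, rfl⟩, fun b hb => h.2 (by rintro _ ⟨c, hc, rfl⟩; exact hb hc)⟩

theorem isGLB_subtype {P : Type*} [PartialOrder P] {p : P → Prop} {A : Set (Subtype p)}
    {a : Subtype p} (h : IsGLB (Subtype.val '' A) a.1) : IsGLB A a :=
  ⟨fun _ hb => h.1 ⟨_, hb, rfl⟩, fun b hb => h.2 (by rintro _ ⟨c, hc, rfl⟩; exact hb hc)⟩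

/-- Countable sets of universally structurable classes have a join among all classes, and it is
universally structurable. -/
theorem UnivStrClass.exists_isLUB {A : Set UnivStrClass} (hA : A.Countable) :
    ∃ j : UnivStrClass, IsLUB (Subtype.val '' A) j.1 := by
  rcases A.eq_empty_or_nonempty with rfl | hne
  · refine ⟨absorbing_empty.universallyStructurable.toClass, ?_⟩
    rw [image_empty]
    exact isLUB_empty_iff.2 fun c => empty_le c
  · obtain ⟨a, rfl⟩ := hA.exists_eq_range hne
    choose E hE h using fun n => (a n).exists_rep
    refine ⟨(Absorbing.sum hE).universallyStructurable.toClass, ?_⟩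
    rw [← range_comp, show Subtype.val ∘ a = fun n => (E n).toIsoClass from (funext h).symm]
    exact isLUB_sum hE

/-- Countable sets of universally structurable classes have a meet among all classes, and it is
universally structurable. -/
theorem UnivStrClass.exists_isGLB {A : Set UnivStrClass} (hA : A.Countable) :
    ∃ m : UnivStrClass, IsGLB (Subtype.val '' A) m.1 := by
  rcases A.eq_empty_or_nonempty with rfl | hne
  · refine ⟨invariantlyUniversal_universal.absorbing.universallyStructurable.toClass, ?_⟩
    rw [image_empty]
    exact isGLB_empty_iff.2 fun c => invariantlyUniversal_universal.le_toIsoClass c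
  · obtain ⟨a, rfl⟩ := hA.exists_eq_range hne
    choose E hE h using fun n => (a n).exists_rep
    have hP := isTensorProduct_tensor E 0
    refine ⟨(hP.absorbing hE).universallyStructurable.toClass, ?_⟩
    rw [← range_comp, show Subtype.val ∘ a = fun n => (E n).toIsoClass from (funext h).symm]
    exact hP.isGLB hE

/-- The join among all classes already lies in the subposet, so uniqueness identifies it with the
given one. -/
theorem UnivStrClass.isLUB_val {A : Set UnivStrClass} (hA : A.Countable) {j : UnivStrClass}
    (hj : IsLUB A j) : IsLUB (Subtype.val '' A) j.1 := by
  obtain ⟨j', hj'⟩ := exists_isLUB hA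
  rwa [hj.unique (isLUB_subtype hj')]

theorem UnivStrClass.isGLB_val {A : Set UnivStrClass} (hA : A.Countable) {m : UnivStrClass}
    (hm : IsGLB A m) : IsGLB (Subtype.val '' A) m.1 := by
  obtain ⟨m', hm'⟩ := exists_isGLB hA
  rwa [hm.unique (isGLB_subtype hm')]

/-- A representative of `t` embeds into the sum of the `Y i`, so it splits into pieces below both
`x` and `y i`, hence below `m i`; summing the pieces bounds it by the join of the `m i`. -/
theorem isLUB_inf_of_isLUB [Countable ι] {x : UnivStrClass} {y m : ι → UnivStrClass}
    {s t : UnivStrClass} (hs : IsLUB (range y) s) (hm : ∀ i, IsGLB {x, y i} (m i))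
    (ht : IsGLB {x, s} t) : IsLUB (range m) t := by
  constructor
  · rintro _ ⟨i, rfl⟩
    refine ht.2 ?_
    rintro _ (rfl | rfl)
    · exact (hm i).1 (Or.inl rfl)
    · exact ((hm i).1 (Or.inr rfl)).trans (hs.1 ⟨i, rfl⟩)
  · intro u hu
    obtain ⟨X, -, hXx⟩ := x.exists_rep
    obtain ⟨T, -, hTt⟩ := t.exists_rep
    choose Y hY hYy using fun i => (y i).exists_rep
    choose M hM hMm using fun i => (m i).exists_rep
    have hs' := UnivStrClass.isLUB_val (countable_range y) hs
    rw [← range_comp, show Subtype.val ∘ y = fun i => (Y i).toIsoClass from (funext hYy).symm] at hs'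
    have hTs : T.toIsoClass ≤ (sum Y).toIsoClass := by
      rw [(isLUB_sum hY).unique hs', hTt]
      exact ht.1 (Or.inr rfl)
    have hTx : T.toIsoClass ≤ X.toIsoClass := by
      rw [hTt, hXx]
      exact ht.1 (Or.inl rfl)
    obtain ⟨T', hT'T, hT'Y, hTT'⟩ := InvEmbeds.exists_pieces hTs
    have hT'M : ∀ i, InvEmbeds (T' i) (M i) := by
      intro i
      change (T' i).toIsoClass ≤ (M i).toIsoClass
      rw [hMm]
      refine (UnivStrClass.isGLB_val (to_countable _) (hm i)).2 ?_
      rintro _ ⟨_, rfl | rfl, rfl⟩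
      · rw [← hXx]
        exact (hT'T i).trans hTx
      · rw [← hYy]
        exact hT'Y i
    change t.1 ≤ u.1
    rw [← hTt]
    refine le_trans (b := (sum M).toIsoClass) (hTT'.trans (InvEmbeds.sum_congr hT'M))
      ((isLUB_sum hM).2 ?_)
    rintro _ ⟨i, rfl⟩
    simp only [hMm]
    exact hu ⟨i, rfl⟩

/-- For a lower bound `u` of the `m i`, each `i` gives an embedding of `U` into the sum of `X` and
`Y i`. The part sent to `X` by some of these is cut into countably many pieces below `x`; the rest
is sent into every `Y i` and so is below `s`. -/
theorem isGLB_sup_of_isGLB [Countable ι] {x : UnivStrClass} {y m : ι → UnivStrClass}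
    {s t : UnivStrClass} (hs : IsGLB (range y) s) (hm : ∀ i, IsLUB {x, y i} (m i))
    (ht : IsLUB {x, s} t) : IsGLB (range m) t := by
  constructor
  · rintro _ ⟨i, rfl⟩
    refine ht.2 ?_
    rintro _ (rfl | rfl)
    · exact (hm i).1 (Or.inl rfl)
    · exact (hs.1 ⟨i, rfl⟩).trans ((hm i).1 (Or.inr rfl))
  · intro u hu
    obtain ⟨X, hX, hXx⟩ := x.exists_rep
    obtain ⟨U, -, hUu⟩ := u.exists_rep
    obtain ⟨S, hS, hSs⟩ := s.exists_rep
    choose Y hY hYy using fun i => (y i).exists_rep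
    have hU : ∀ i, InvEmbeds U (sum fun b : Bool => cond b (Y i) X) := by
      intro i
      change U.toIsoClass ≤ (sum fun b : Bool => cond b (Y i) X).toIsoClass
      rw [hUu]
      refine (show u.1 ≤ (m i).1 from hu ⟨i, rfl⟩).trans
        ((UnivStrClass.isLUB_val (to_countable _) (hm i)).2 ?_)
      rintro _ ⟨_, rfl | rfl, rfl⟩
      · rw [← hXx]
        exact ⟨_, isInvariantEmbedding_mk (E := fun b : Bool => cond b (Y i) X) false⟩
      · rw [← hYy]
        exact ⟨_, isInvariantEmbedding_mk (E := fun b : Bool => cond b (Y i) X) true⟩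
    choose f hf using hU
    have hfm := fun i b => measurableSet_fibre (hf i).isClassBijective b
    have hfinv := fun i => fst_eq_of_rel (hf i).isClassBijective
    -- The summand `X` has label `false`. Thus `c` gives the first `i` whose embedding sends the
    -- point to `X`, and `none` when all send it to the `Y i`.
    obtain ⟨c, hc, hcinv, hsome, hnone⟩ := U.exists_first (fun i => hfm i false)
      fun i x y h (hx : sumFst (f i x) = false) => (hfinv i x y h).symm.trans hx
    have hpiece : ∀ i b (Z : Set U.carrier) (hZ : MeasurableSet Z),
        (∀ x y, U.rel x y → x ∈ Z → y ∈ Z) → (∀ x ∈ Z, sumFst (f i x) = b) →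
        InvEmbeds (U.restrict Z hZ) (cond b (Y i) X) := by
      intro i b Z hZ hZinv hZb
      obtain ⟨g, hg, hgf⟩ := exists_isClassBijective_fibre (hf i).isClassBijective b (hfm i b)
      have hgi : IsInvariantEmbedding (U.restrict _ (hfm i b)) _ g := hg.isInvariantEmbedding fun x y h =>
        Subtype.ext ((hf i).injective (by rw [← hgf, ← hgf, h]))
      let incl : (U.restrict Z hZ).carrier → (U.restrict _ (hfm i b)).carrier :=
        fun x => ⟨x.1, hZb x.1 x.2⟩
      have hincl : IsInvariantEmbedding (U.restrict Z hZ) (U.restrict _ (hfm i b)) incl :=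
        ⟨measurable_subtype_coe.subtype_mk, fun x y h => Subtype.ext (congrArg Subtype.val h :),
          fun _ _ => Iff.rfl, fun x y h => ⟨⟨y.1, hZinv _ _ h x.2⟩, rfl⟩⟩
      exact ⟨_, hgi.comp hincl⟩
    -- Repeated copies of `X` do no harm: the sum of absorbing relations is the join, and joins
    -- ignore repetition.
    let W : Option ι → CBER := fun o => o.elim S fun _ => X
    have hUW : ∀ o, InvEmbeds (U.restrict {x | c x = o} (hc o)) (W o) := by
      have hinv : ∀ o x y, U.rel x y → x ∈ {x | c x = o} → y ∈ {x | c x = o} :=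
        fun o x y h (hx : c x = o) => (hcinv x y h).symm.trans hx
      rintro (_ | i)
      · change toIsoClass _ ≤ S.toIsoClass
        rw [hSs]
        refine (UnivStrClass.isGLB_val (countable_range y) hs).2 ?_
        rintro _ ⟨_, ⟨i, rfl⟩, rfl⟩
        rw [← hYy]
        exact hpiece i true _ _ (hinv none) fun x hx => Bool.eq_true_of_not_eq_false (hnone x hx i)
      · exact hpiece i false _ _ (hinv (some i)) fun x hx => hsome x i hx
    have hW : ∀ o, (W o).Absorbing := by
      rintro (_ | i)
      · exact hS
      · exact hX
    choose g hg using hUW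
    change u.1 ≤ t.1
    rw [← hUu]
    refine le_trans (b := (sum W).toIsoClass) ⟨_, isInvariantEmbedding_glue hcinv hg⟩
      ((isLUB_sum hW).2 ?_)
    rintro _ ⟨_ | i, rfl⟩
    · change S.toIsoClass ≤ _
      rw [hSs]
      exact ht.1 (Or.inr rfl)
    · change X.toIsoClass ≤ _
      rw [hXx]
      exact ht.1 (Or.inl rfl)

theorem isOmega1DistributiveLattice_univStrClass : IsOmega1DistributiveLattice UnivStrClass where
  complete _ hA :=
    ⟨(UnivStrClass.exists_isGLB hA).imp fun _ => isGLB_subtype,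
      (UnivStrClass.exists_isLUB hA).imp fun _ => isLUB_subtype⟩
  inf_iSup _ _ _ _ _ _ _ := isLUB_inf_of_isLUB
  sup_iInf _ _ _ _ _ _ _ := isGLB_sup_of_isGLB

end Lattice

end CBER

/-- The poset of universally structurable isomorphism classes under invariant Borel embeddability is
an `ω₁`-distributive lattice, with joins `⨁`, nonempty meets `⨂`, greatest element `E_∞` and least
element `∅`; its inclusion into the poset of all isomorphism classes preserves countable meets and
joins, which are there given by the same operations. -/
theorem theorem5p4 :
    -- the poset is an `ω₁`-distributive lattice
    IsOmega1DistributiveLattice CBER.UnivStrClass ∧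
    -- joins are given by disjoint sums, in the subposet and among all isomorphism classes
    (∀ (ι : Type) [Countable ι] (E : ι → CBER) (hE : ∀ i, (E i).UniversallyStructurable),
      ∃ h : (CBER.sum E).UniversallyStructurable,
        IsLUB (range fun i => (hE i).toClass) h.toClass ∧
        IsLUB (range fun i => (E i).toIsoClass) (CBER.sum E).toIsoClass) ∧
    -- nonempty meets are given by tensor products, in the subposet and among all classes
    (∀ (ι : Type) [Countable ι] [Nonempty ι] (E : ι → CBER)
      (hE : ∀ i, (E i).UniversallyStructurable),
      (∃ (P : CBER) (π : ∀ i, P.carrier → (E i).carrier), CBER.IsTensorProduct E P π) ∧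
      ∀ (P : CBER) (π : ∀ i, P.carrier → (E i).carrier), CBER.IsTensorProduct E P π →
        ∃ h : P.UniversallyStructurable,
          IsGLB (range fun i => (hE i).toClass) h.toClass ∧
          IsGLB (range fun i => (E i).toIsoClass) P.toIsoClass) ∧
    -- there is an invariantly universal `E_∞`, and it is the greatest element
    (∃ E : CBER, E.InvariantlyUniversal) ∧
    (∀ E : CBER, E.InvariantlyUniversal → ∃ h : E.UniversallyStructurable, IsTop h.toClass) ∧
    -- the empty equivalence relation is the least element
    (∃ h : CBER.empty.UniversallyStructurable, IsBot h.toClass) ∧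
    -- the inclusion into all isomorphism classes preserves countable meets and joins
    (∀ A : Set CBER.UnivStrClass, A.Countable →
      (∀ m, IsGLB A m → IsGLB (Subtype.val '' A) m.val) ∧
      (∀ j, IsLUB A j → IsLUB (Subtype.val '' A) j.val)) := by
  refine ⟨CBER.isOmega1DistributiveLattice_univStrClass, fun ι _ E hE => ?_, fun ι _ _ E hE => ?_,
    ⟨_, CBER.invariantlyUniversal_universal⟩, fun E hE => ⟨hE.absorbing.universallyStructurable,
      fun c => hE.le_toIsoClass c.1⟩, ⟨CBER.absorbing_empty.universallyStructurable,
      fun c => CBER.empty_le c.1⟩,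
    fun _ hA => ⟨fun _ => CBER.UnivStrClass.isGLB_val hA, fun _ => CBER.UnivStrClass.isLUB_val hA⟩⟩
  · have hE' := fun i => (hE i).absorbing
    refine ⟨(CBER.Absorbing.sum hE').universallyStructurable, CBER.isLUB_subtype ?_,
      CBER.isLUB_sum hE'⟩
    rw [← range_comp]
    exact CBER.isLUB_sum hE'
  · have hE' := fun i => (hE i).absorbing
    refine ⟨⟨_, _, CBER.isTensorProduct_tensor E (Classical.arbitrary ι)⟩, fun P π hP =>
      ⟨(hP.absorbing hE').universallyStructurable, CBER.isGLB_subtype ?_, hP.isGLB hE'⟩⟩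
    rw [← range_comp]
    exact hP.isGLB hE'
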